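/- **Theorem 3.6.** Let $0<d<\pi/2$, $\mathscr{D}_d=\{\zeta\in\mathbb{C}:|\operatorname{Im}\zeta|<d\}$, and $\psi(\zeta)=\log(1+e^{\pi\sinh\zeta})$, where $\log$ is taken as the branch that makes $\psi$ analytic in $\mathscr{D}_d$ and real on $\mathbb{R}$ (the function $1+e^{\pi\sinh\zeta}$ has no zeros in $\mathscr{D}_d$). Then $\psi$ maps $\mathbb{R}$ bijectively onto $(0,\infty)$, with inverse $\psi^{-1}(\tau)=\operatorname{arcsinh}(\pi^{-1}\log(e^{\tau}-1))$. Let $K>0$, $0<\alpha\le 1$ and $\beta>0$. Let $f$ be a complex-valued function that is analytic in $\psi(\mathscr{D}_d)$ and satisfies $$|f(z)|\le K\left|\left(\frac{z}{1+z}\right)^{\alpha-1}e^{-\beta z}\right|\qquad\text{for all } z\in\psi(\mathscr{D}_d)$$ (if $\alpha<1$ and $z=-1$, the right-hand side is read as $0$; if $\alpha=1$, the power is read as $1$). Let $\mu=\min\{\alpha,\beta\}$ and $\nu=\max\{\alpha,\beta\}$. For a positive integer $n$ put $h=\log(2dn/\mu)/n$ and $$M=n,\quad N=n-\lfloor\log(\beta/\alpha)/h\rfloor\quad(\text{if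 }\mu=\alpha),\qquad N=n,\quad M=n-\lfloor\log(\alpha/\beta)/h\rfloor\quad(\text{if }\mu=\beta).$$ For $\gamma>0$ let $$x_\gamma=\operatorname{arcsinh}\left(\frac{\sqrt{1+\sqrt{1-(2\pi\gamma)^2}}}{2\pi\gamma}\right)\ \text{ if } \gamma<\frac1{2\pi},\qquad x_\gamma=\operatorname{arcsinh}(1)\ \text{ if }\gamma\ge\frac1{2\pi},$$ and assume that $n$ is so large that $n\ge \nu e/(2d)$, $Mh\ge x_\alpha$ and $Nh\ge x_\beta$. Put $$J(k,h)(x)=h\left\{\frac12+\frac1\pi\operatorname{Si}[\pi(x/h-k)]\right\},\qquad \operatorname{Si}(x)=\int_0^x\frac{\sin\sigma}{\sigma}\,d\sigma .$$ Then $f$ is integrable on $(0,\tau)$ for every $\tau>0$, and $$\sup_{\tau\in(0,\infty)}\left|\int_0^\tau f(t)\,dt-\sum_{k=-M}^{N}f(\psi(kh))\,\psi'(kh)\,J(k,h)(\psi^{-1}(\tau))\right|\le C_{3\ddagger}\,\frac{\log(2dn/\mu)}{n}\,e^{-\pi dn/\log(2dn/\mu)},$$ where $C_{3\ddagger}$ does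 not depend on $n$: $$C_{3\ddagger}=\frac{2K}{\mu d}\left\{\frac{\tilde c_d^{\,1-\alpha}}{(1-e^{-\pi\mu e})\{\cos(\frac\pi2\sin d)\}^{\alpha+\beta}\cos d}+e^{\pi(1+5\alpha+6\beta)/12}\right\},$$ $$\tilde c_d=\frac{1+\log(1+c_d)}{\log(1+c_d)}\,c_d,\qquad c_d=1+\frac1{\cos(\frac\pi2\sin d)} .$$ -/

import Mathlib

noncomputable section

namespace SincDE

/-- The strip of complex numbers whose imaginary part is less than `d` in absolute value. -/
def strip (d : ℝ) : Set ℂ := {ζ : ℂ | |ζ.im| < d}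

/-- The analytic branch of `log (1 + exp w)` on the plane cut along the two half-lines
`{i t : |t| ≥ π}` that is real on the real axis. It is the principal value of `log (1 + exp w)`
in the left half-plane; in the right half-plane, where that principal value jumps, it is
`w + log (1 + exp (-w))`. -/
def softplus (w : ℂ) : ℂ :=
  if w.re < 0 then Complex.log (1 + Complex.exp w)
  else w + Complex.log (1 + Complex.exp (-w))

/-- The double-exponential map `log (1 + exp (π sinh ζ))` on the strip `|Im ζ| < π / 2`. -/
def psi (ζ : ℂ) : ℂ := softplus (Real.pi * Complex.sinh ζ)

/-- The double-exponential map on the real line, `x ↦ log (1 + exp (π sinh x))`. -/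
def psiReal (x : ℝ) : ℝ := Real.log (1 + Real.exp (Real.pi * Real.sinh x))

/-- The inverse of `psiReal`, from `(0, ∞)` to `ℝ`. -/
def psiInv (τ : ℝ) : ℝ := Real.arsinh (Real.log (Real.exp τ - 1) / Real.pi)

/-- The comparison function `(z / (1 + z)) ^ (α - 1) * exp (-β z)`; only its norm, which does not
depend on the branch of the power, is used. For `α < 1` its value at `z = -1` is the limit `0`. -/
def E3 (α β : ℝ) (z : ℂ) : ℂ :=
  (z / (1 + z)) ^ ((α : ℂ) - 1) * Complex.exp (-(β : ℂ) * z)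

/-- The sine integral. -/
def Si (x : ℝ) : ℝ := ∫ σ in (0 : ℝ)..x, Real.sinc σ

/-- The basis functions `J(k,h)` of the Sinc indefinite integration. -/
def J (k : ℤ) (h x : ℝ) : ℝ := h * (1 / 2 + 1 / Real.pi * Si (Real.pi * (x / h - k)))

/-- The threshold `x_γ` for `γ > 0`. -/
def xThreshold (γ : ℝ) : ℝ :=
  if γ < 1 / (2 * Real.pi) then
    Real.arsinh (√(1 + √(1 - (2 * Real.pi * γ) ^ 2)) / (2 * Real.pi * γ))
  else Real.arsinh 1

/-- The lower truncation number `M` (an integer). -/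
def lowerM (α β h : ℝ) (n : ℕ) : ℤ :=
  if α ≤ β then (n : ℤ) else (n : ℤ) - ⌊Real.log (α / β) / h⌋

/-- The upper truncation number `N` (an integer). -/
def upperN (α β h : ℝ) (n : ℕ) : ℤ :=
  if α ≤ β then (n : ℤ) - ⌊Real.log (β / α) / h⌋ else (n : ℤ)

/-- The rate `exp (-π d n / log (4 d n / μ)) * log (4 d n / μ) / n`. -/
def epsDE (d μ : ℝ) (n : ℕ) : ℝ :=
  Real.exp (-(Real.pi * d * n) / Real.log (4 * d * n / μ)) * Real.log (4 * d * n / μ) / n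

/-- The constant `c_d`. -/
def cD (d : ℝ) : ℝ := 1 + 1 / Real.cos (Real.pi / 2 * Real.sin d)

/-- The constant `c̃_d`. -/
def cTilde (d : ℝ) : ℝ := (1 + Real.log (1 + cD d)) / Real.log (1 + cD d) * cD d

/-- The explicit constant of the error bound, where `μ = min α β`. -/
def errConst (d K α β : ℝ) : ℝ :=
  2 * K / (min α β * d) *
    (cTilde d ^ (1 - α) /
        ((1 - Real.exp (-(Real.pi * min α β * Real.exp 1))) *
          Real.cos (Real.pi / 2 * Real.sin d) ^ (α + β) * Real.cos d) +
      Real.exp (Real.pi * (1 + 5 * α + 6 * β) / 12))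

/-! Checks that the branch is the intended one and that the inverse is the inverse. -/

theorem one_add_exp_mem_slitPlane {w : ℂ} (h : w.re < 0 ∨ |w.im| < Real.pi) :
    1 + Complex.exp w ∈ Complex.slitPlane := by
  rw [Complex.mem_slitPlane_iff]
  rcases h with h | h
  · left
    have h1 : |(Complex.exp w).re| ≤ ‖Complex.exp w‖ := Complex.abs_re_le_norm _
    rw [Complex.norm_exp] at h1
    have h2 : Real.exp w.re < 1 := by simpa using h
    have := (abs_le.1 h1).1
    simp only [Complex.add_re, Complex.one_re]
    linarith
  · by_cases h0 : w.im = 0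
    · left
      simp only [Complex.add_re, Complex.one_re, Complex.exp_re, h0, Real.cos_zero, mul_one]
      positivity
    · right
      simp only [Complex.add_im, Complex.one_im, Complex.exp_im, zero_add]
      obtain ⟨h1, h2⟩ := abs_lt.1 h
      have : Real.sin w.im ≠ 0 := by
        rcases lt_or_gt_of_ne h0 with h3 | h3
        · exact (Real.sin_neg_of_neg_of_neg_pi_lt h3 h1).ne
        · exact (Real.sin_pos_of_pos_of_lt_pi h3 h2).ne'
      exact mul_ne_zero (Real.exp_pos _).ne' this

theorem softplus_branches_agree {w : ℂ} (h : |w.im| < Real.pi) :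
    Complex.log (1 + Complex.exp w) = w + Complex.log (1 + Complex.exp (-w)) := by
  have hs := one_add_exp_mem_slitPlane (w := w) (Or.inr h)
  have hs' := one_add_exp_mem_slitPlane (w := -w) (Or.inr (by simpa using h))
  have hw : w + Complex.log (1 + Complex.exp (-w))
      = Complex.log (1 + Complex.exp w) ↔ True := by
    simp only [iff_true]
    have e : Complex.exp (w + Complex.log (1 + Complex.exp (-w)))
        = 1 + Complex.exp w := by
      rw [Complex.exp_add, Complex.exp_log (Complex.slitPlane_ne_zero hs'), mul_add,
        ← Complex.exp_add]
      simp [add_comm]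
    rw [← e]
    symm
    have key : -Real.pi < w.im + (1 + Complex.exp (-w)).arg ∧
        w.im + (1 + Complex.exp (-w)).arg ≤ Real.pi := by
      obtain ⟨h1, h2⟩ := abs_lt.1 h
      have im' : (1 + Complex.exp (-w)).im = -(Real.exp (-w.re) * Real.sin w.im) := by
        simp [Complex.exp_im]
      have ha := Complex.neg_pi_lt_arg (1 + Complex.exp (-w))
      have hb := Complex.arg_le_pi (1 + Complex.exp (-w))
      rcases lt_trichotomy w.im 0 with h0 | h0 | h0
      · have : 0 ≤ (1 + Complex.exp (-w)).arg := by
          rw [Complex.arg_nonneg_iff, im']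
          have := Real.sin_neg_of_neg_of_neg_pi_lt h0 h1
          have := Real.exp_pos (-w.re)
          nlinarith
        constructor <;> linarith
      · constructor <;> linarith
      · have : (1 + Complex.exp (-w)).arg < 0 := by
          rw [Complex.arg_neg_iff, im']
          have := Real.sin_pos_of_pos_of_lt_pi h0 h2
          have := Real.exp_pos (-w.re)
          nlinarith
        constructor <;> linarith
    apply Complex.log_exp
    · simpa [Complex.log_im] using key.1
    · simpa [Complex.log_im] using key.2
  exact (hw.2 trivial).symm

/-- `softplus` is a logarithm of `1 + exp w`. -/
theorem exp_softplus {w : ℂ} (h : w.re ≠ 0 ∨ |w.im| < Real.pi) :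
    Complex.exp (softplus w) = 1 + Complex.exp w := by
  unfold softplus
  split_ifs with h0
  · exact Complex.exp_log (Complex.slitPlane_ne_zero (one_add_exp_mem_slitPlane (Or.inl h0)))
  · have hs : 1 + Complex.exp (-w) ∈ Complex.slitPlane := by
      apply one_add_exp_mem_slitPlane
      rcases h with h | h
      · left
        simpa using lt_of_le_of_ne (not_lt.1 h0) h.symm
      · right
        simpa using h
    rw [Complex.exp_add, Complex.exp_log (Complex.slitPlane_ne_zero hs), mul_add,
      ← Complex.exp_add]
    simp [add_comm]

/-- `softplus` is holomorphic off the two cuts. -/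
theorem differentiableAt_softplus {w : ℂ} (h : w.re ≠ 0 ∨ |w.im| < Real.pi) :
    DifferentiableAt ℂ softplus w := by
  have hA : ∀ {z : ℂ}, (z.re < 0 ∨ |z.im| < Real.pi) →
      DifferentiableAt ℂ (fun z => Complex.log (1 + Complex.exp z)) z := fun hz =>
    DifferentiableAt.clog (by fun_prop) (one_add_exp_mem_slitPlane hz)
  have hB : ∀ {z : ℂ}, 0 < z.re →
      DifferentiableAt ℂ (fun z => z + Complex.log (1 + Complex.exp (-z))) z := fun hz =>
    differentiableAt_id.add
      (DifferentiableAt.clog (by fun_prop) (one_add_exp_mem_slitPlane (Or.inl (by simpa using hz))))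
  by_cases hi : |w.im| < Real.pi
  · refine (hA (Or.inr hi)).congr_of_eventuallyEq ?_
    have ho : IsOpen {z : ℂ | |z.im| < Real.pi} :=
      isOpen_lt (Complex.continuous_im.abs) continuous_const
    filter_upwards [ho.mem_nhds hi] with z hz
    unfold softplus
    split_ifs
    · rfl
    · exact (softplus_branches_agree hz).symm
  · rcases lt_or_gt_of_ne (h.resolve_right hi) with hr | hr
    · refine (hA (Or.inl hr)).congr_of_eventuallyEq ?_
      filter_upwards [(isOpen_lt Complex.continuous_re continuous_const).mem_nhds hr] with z hz
      have hz' : z.re < 0 := hz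
      simp [softplus, hz']
    · refine (hB hr).congr_of_eventuallyEq ?_
      filter_upwards [(isOpen_lt continuous_const Complex.continuous_re).mem_nhds hr] with z hz
      have hz' : ¬ z.re < 0 := not_lt.2 (le_of_lt hz)
      simp [softplus, hz']

theorem pi_sinh_avoids_cuts {ζ : ℂ} (h : ζ ∈ strip (Real.pi / 2)) :
    (Real.pi * Complex.sinh ζ).re ≠ 0 ∨ |(Real.pi * Complex.sinh ζ).im| < Real.pi := by
  have hz : |ζ.im| < Real.pi / 2 := h
  obtain ⟨h1, h2⟩ := abs_lt.1 hz
  have hc : 0 < Real.cos ζ.im := Real.cos_pos_of_mem_Ioo ⟨h1, h2⟩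
  have e : Complex.sinh ζ = (Real.sinh ζ.re * Real.cos ζ.im : ℝ)
      + (Real.cosh ζ.re * Real.sin ζ.im : ℝ) * Complex.I := by
    conv_lhs => rw [← Complex.re_add_im ζ, Complex.sinh_add, Complex.sinh_mul_I,
      Complex.cosh_mul_I]
    push_cast
    ring
  have er : (Complex.sinh ζ).re = Real.sinh ζ.re * Real.cos ζ.im := by
    rw [e]; simp [-Complex.ofReal_mul]
  have ei : (Complex.sinh ζ).im = Real.cosh ζ.re * Real.sin ζ.im := by
    rw [e]; simp [-Complex.ofReal_mul]
  rw [Complex.re_ofReal_mul, Complex.im_ofReal_mul, er, ei]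
  by_cases h0 : ζ.re = 0
  · right
    rw [h0, Real.cosh_zero, one_mul, abs_mul, abs_of_pos Real.pi_pos]
    have : |Real.sin ζ.im| < 1 := by
      rw [← sq_lt_one_iff_abs_lt_one]
      nlinarith [Real.sin_sq_add_cos_sq ζ.im]
    nlinarith [Real.pi_pos]
  · left
    have : Real.sinh ζ.re ≠ 0 := by simpa using h0
    exact mul_ne_zero Real.pi_pos.ne' (mul_ne_zero this hc.ne')

theorem exp_psi {ζ : ℂ} (h : ζ ∈ strip (Real.pi / 2)) :
    Complex.exp (psi ζ) = 1 + Complex.exp (Real.pi * Complex.sinh ζ) :=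
  exp_softplus (pi_sinh_avoids_cuts h)

theorem differentiableOn_psi : DifferentiableOn ℂ psi (strip (Real.pi / 2)) := fun ζ h =>
  ((differentiableAt_softplus (pi_sinh_avoids_cuts h)).comp ζ
    (by fun_prop : DifferentiableAt ℂ (fun ζ => Real.pi * Complex.sinh ζ) ζ)).differentiableWithinAt

theorem psi_ofReal (x : ℝ) : psi x = psiReal x := by
  have h : |((Real.pi : ℂ) * Complex.sinh x).im| < Real.pi := by
    rw [Complex.im_ofReal_mul, Complex.sinh_ofReal_im]
    simpa using Real.pi_pos
  have e : psi x = Complex.log (1 + Complex.exp (Real.pi * Complex.sinh x)) := by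
    unfold psi softplus
    split_ifs
    · rfl
    · exact (softplus_branches_agree h).symm
  rw [e, psiReal, Complex.ofReal_log (by positivity)]
  push_cast
  rfl

theorem psiReal_pos (x : ℝ) : 0 < psiReal x :=
  Real.log_pos (by linarith [Real.exp_pos (Real.pi * Real.sinh x)])

theorem psiInv_psiReal (x : ℝ) : psiInv (psiReal x) = x := by
  unfold psiInv psiReal
  rw [Real.exp_log (by positivity), add_sub_cancel_left, Real.log_exp,
    mul_div_cancel_left₀ _ Real.pi_pos.ne', Real.arsinh_sinh]

theorem psiReal_psiInv {τ : ℝ} (h : 0 < τ) : psiReal (psiInv τ) = τ := by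
  unfold psiInv psiReal
  have h1 : 0 < Real.exp τ - 1 := by linarith [Real.one_lt_exp_iff.2 h]
  rw [Real.sinh_arsinh, mul_div_cancel₀ _ Real.pi_pos.ne', Real.exp_log h1,
    add_sub_cancel, Real.log_exp]

end SincDE

end

/-!
The substitution `t = ψ x` turns the integral over `(0, τ)` into the integral over
`(-∞, ψ⁻¹ τ]` of `F = f(ψ) ψ'`, which is holomorphic in the strip `|Im ζ| < d` and decays there
double-exponentially. On a line `Im ζ = D` it is dominated by a multiple of
`cosh t * exp (-k |sinh t|)`, whose primitive is elementary, so its `L¹` norm there is explicit.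

Interpolating `F` at the nodes `k h` by sinc functions leaves, by the residue theorem, the integral
over the boundary of the strip of
`F z * sin (π x / h) / (2 π i * (z - x) * sin (π z / h))`. Integrate it in `x` first: the
oscillation of the sine makes the integral of `sin (π x / h) / (z - x)` of size `h / D`, and
`|1 / sin (π z / h)| ≤ 1 / sinh (π D / h)`. Letting `D → d` bounds the discretization error by a
multiple of `h exp (-π d / h)`. The neglected terms of the series telescope against
`exp (-π γ sinh)`, and `h = log (2 d n / μ) / n` makes them of the same order.
-/

namespace SincDE

open Complex Filter MeasureTheory Set Topology

section Rectangle

variable {f g : ℂ → ℂ} {a b c D h : ℝ}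

/-- The contour integral of `f` over the positively oriented boundary of the rectangle
`[a, b] × [-D, D]`. -/
noncomputable def rectIntegral (f : ℂ → ℂ) (a b D : ℝ) : ℂ :=
  (∫ x in a..b, f (x + (-D : ℝ) * I)) - (∫ x in a..b, f (x + D * I)) +
    I * (∫ y in (-D)..D, f (b + y * I)) - I * ∫ y in (-D)..D, f (a + y * I)

/-- The contour integral of `f` over the positively oriented boundary of the strip
`|Im z| ≤ D`. -/
noncomputable def stripIntegral (f : ℂ → ℂ) (D : ℝ) : ℂ :=
  (∫ x : ℝ, f (x + (-D : ℝ) * I)) - ∫ x : ℝ, f (x + D * I)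

/-- The boundary of the rectangle `[a, b] × [-D, D]`. -/
def rectBoundary (a b D : ℝ) : Set ℂ :=
  (Icc a b ×ℂ Icc (-D) D) \ (Ioo a b ×ℂ Ioo (-D) D)

theorem horizontal_mem_rectBoundary {x y : ℝ} (hx : x ∈ Icc a b) (hy : |y| = D) :
    (x : ℂ) + y * I ∈ rectBoundary a b D := by
  rcases eq_or_eq_neg_of_abs_eq hy with rfl | rfl <;>
    simp_all [rectBoundary, mem_reProdIm, abs_le.1 hy.le]

theorem vertical_mem_rectBoundary {x y : ℝ} (hab : a ≤ b) (hx : x = a ∨ x = b)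
    (hy : y ∈ Icc (-D) D) : (x : ℂ) + y * I ∈ rectBoundary a b D := by
  rcases hx with rfl | rfl <;> simp_all [rectBoundary, mem_reProdIm]

theorem rectIntegral_eq_zero
    (hf : DifferentiableOn ℂ f (uIcc a b ×ℂ uIcc (-D) D)) : rectIntegral f a b D = 0 := by
  have := integral_boundary_rect_eq_zero_of_differentiableOn f ⟨a, -D⟩ ⟨b, D⟩ (by simpa using hf)
  simpa [rectIntegral] using this

theorem rectIntegral_congr (hab : a ≤ b) (hD : 0 ≤ D) (h : EqOn f g (rectBoundary a b D)) :
    rectIntegral f a b D = rectIntegral g a b D := by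
  have horizontal (y : ℝ) (hy : |y| = D) :
      ∫ x in a..b, f (x + y * I) = ∫ x in a..b, g (x + y * I) :=
    intervalIntegral.integral_congr fun x hx =>
      h (horizontal_mem_rectBoundary (uIcc_of_le hab ▸ hx) hy)
  have vertical (x : ℝ) (hx : x = a ∨ x = b) :
      ∫ y in (-D)..D, f (x + y * I) = ∫ y in (-D)..D, g (x + y * I) :=
    intervalIntegral.integral_congr fun y hy =>
      h (vertical_mem_rectBoundary hab hx (uIcc_of_le (neg_le_self hD) ▸ hy))
  rw [rectIntegral, rectIntegral, horizontal D (abs_of_nonneg hD),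
    horizontal (-D) (by rw [abs_neg, abs_of_nonneg hD]), vertical a (.inl rfl),
    vertical b (.inr rfl)]

theorem rectIntegral_add (hab : a ≤ b) (hD : 0 ≤ D) (hf : ContinuousOn f (rectBoundary a b D))
    (hg : ContinuousOn g (rectBoundary a b D)) :
    rectIntegral (fun z => f z + g z) a b D = rectIntegral f a b D + rectIntegral g a b D := by
  have horizontal {k : ℂ → ℂ} (hk : ContinuousOn k (rectBoundary a b D)) {y : ℝ} (hy : |y| = D) :
      IntervalIntegrable (fun x : ℝ => k (x + y * I)) volume a b :=
    ContinuousOn.intervalIntegrable <| hk.comp (by fun_prop) fun x hx =>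
      horizontal_mem_rectBoundary (uIcc_of_le hab ▸ hx) hy
  have vertical {k : ℂ → ℂ} (hk : ContinuousOn k (rectBoundary a b D)) {x : ℝ}
      (hx : x = a ∨ x = b) : IntervalIntegrable (fun y : ℝ => k (x + y * I)) volume (-D) D :=
    ContinuousOn.intervalIntegrable <| hk.comp (by fun_prop) fun y hy =>
      vertical_mem_rectBoundary hab hx (uIcc_of_le (neg_le_self hD) ▸ hy)
  have hD₁ : |D| = D := abs_of_nonneg hD
  have hD₂ : |-D| = D := by rw [abs_neg, hD₁]
  rw [rectIntegral, intervalIntegral.integral_add (horizontal hf hD₂) (horizontal hg hD₂),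
    intervalIntegral.integral_add (horizontal hf hD₁) (horizontal hg hD₁),
    intervalIntegral.integral_add (vertical hf (.inr rfl)) (vertical hg (.inr rfl)),
    intervalIntegral.integral_add (vertical hf (.inl rfl)) (vertical hg (.inl rfl)),
    rectIntegral, rectIntegral]
  ring

theorem rectIntegral_const_mul (r : ℂ) (f : ℂ → ℂ) (a b D : ℝ) :
    rectIntegral (fun z => r * f z) a b D = r * rectIntegral f a b D := by
  simp only [rectIntegral, intervalIntegral.integral_const_mul]
  ring

theorem rectIntegral_comp_sub (f : ℂ → ℂ) (a b c D : ℝ) :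
    rectIntegral (fun z => f (z - c)) a b D = rectIntegral f (a - c) (b - c) D := by
  have horizontal (y : ℝ) :
      ∫ x in a..b, f (x + y * I - c) = ∫ x in (a - c)..(b - c), f (x + y * I) := by
    rw [← intervalIntegral.integral_comp_sub_right (fun x : ℝ => f (x + y * I)) c]
    simp only [ofReal_sub, sub_add_eq_add_sub]
  have vertical (x : ℝ) :
      ∫ y in (-D)..D, f (x + y * I - c) = ∫ y in (-D)..D, f ((x - c : ℝ) + y * I) := by
    simp only [ofReal_sub, sub_add_eq_add_sub]
  simp only [rectIntegral, horizontal, vertical]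

theorem ofReal_add_mul_I_ne_zero {y : ℝ} (hy : y ≠ 0) (x : ℝ) : (x : ℂ) + y * I ≠ 0 := fun h =>
  hy (by simpa using congrArg im h)

theorem continuous_inv_ofReal_add_mul_I {y : ℝ} (hy : y ≠ 0) :
    Continuous fun x : ℝ => ((x : ℂ) + y * I)⁻¹ :=
  Continuous.inv₀ (by fun_prop) (ofReal_add_mul_I_ne_zero hy)

theorem integral_inv_sub_integral_inv_horizontal (hD : D ≠ 0) (R : ℝ) :
    ((∫ x in (-R)..R, ((x : ℂ) + (-D : ℝ) * I)⁻¹) - ∫ x in (-R)..R, ((x : ℂ) + D * I)⁻¹) =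
      4 * Real.arctan (R / D) * I := by
  have kernel (x : ℝ) : ((x : ℂ) + (-D : ℝ) * I)⁻¹ - ((x : ℂ) + D * I)⁻¹ =
      2 * I * ((D / (D ^ 2 + x ^ 2) : ℝ) : ℂ) := by
    have h₁ := ofReal_add_mul_I_ne_zero (neg_ne_zero.2 hD) x
    have h₂ := ofReal_add_mul_I_ne_zero hD x
    have h₃ : (D : ℂ) ^ 2 + x ^ 2 ≠ 0 := by
      have : (0 : ℝ) < D ^ 2 + x ^ 2 := by positivity
      exact_mod_cast this.ne'
    rw [inv_sub_inv h₁ h₂]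
    push_cast at h₁ ⊢
    rw [mul_div_assoc', div_eq_div_iff (mul_ne_zero h₁ h₂) h₃]
    linear_combination (2 * D * I * D ^ 2) * I_sq
  rw [← intervalIntegral.integral_sub
    ((continuous_inv_ofReal_add_mul_I (neg_ne_zero.2 hD)).intervalIntegrable _ _)
    ((continuous_inv_ofReal_add_mul_I hD).intervalIntegrable _ _)]
  simp_rw [kernel]
  rw [intervalIntegral.integral_const_mul, intervalIntegral.integral_ofReal,
    integral_div_sq_add_sq, neg_div, Real.arctan_neg]
  push_cast
  ring

theorem rectIntegral_inv {R : ℝ} (hR : 0 < R) (hD : 0 < D) :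
    rectIntegral (fun z => z⁻¹) (-R) R D = 2 * Real.pi * I := by
  have vertical (x : ℝ) : I * (∫ y in (-D)..D, ((x : ℂ) + y * I)⁻¹) =
      ∫ y in (-D)..D, ((y : ℂ) + (-x : ℝ) * I)⁻¹ := by
    rw [← intervalIntegral.integral_const_mul]
    refine intervalIntegral.integral_congr fun y _ => ?_
    have rotate : (x : ℂ) + y * I = I * (y + (-x : ℝ) * I) := by
      push_cast
      linear_combination (x : ℂ) * I_sq
    simp only [rotate, mul_inv, mul_inv_cancel_left₀ I_ne_zero]
  have angles := Real.arctan_inv_of_pos (div_pos hR hD)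
  rw [inv_div] at angles
  rw [rectIntegral, vertical, vertical, neg_neg, add_sub_assoc,
    integral_inv_sub_integral_inv_horizontal hD.ne',
    integral_inv_sub_integral_inv_horizontal hR.ne', angles]
  push_cast
  ring

theorem rectIntegral_div_sub {R : ℝ} (hR : 0 < R) (hD : 0 < D)
    (hg : DifferentiableOn ℂ g (Icc (c - R) (c + R) ×ℂ Icc (-D) D)) :
    rectIntegral (fun z => g z / (z - c)) (c - R) (c + R) D = 2 * Real.pi * I * g c := by
  have hab : c - R ≤ c + R := by linarith
  have hnhds : Icc (c - R) (c + R) ×ℂ Icc (-D) D ∈ 𝓝 (c : ℂ) :=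
    mem_of_superset ((isOpen_Ioo.reProdIm isOpen_Ioo).mem_nhds (by simp [mem_reProdIm, hR, hD]))
      (reProdIm_subset_iff.2 (prod_mono Ioo_subset_Icc_self Ioo_subset_Icc_self))
  have hslope : DifferentiableOn ℂ (dslope g c) (Icc (c - R) (c + R) ×ℂ Icc (-D) D) :=
    (differentiableOn_dslope hnhds).2 hg
  have hne : ∀ z ∈ rectBoundary (c - R) (c + R) D, z - (c : ℂ) ≠ 0 := by
    rintro z ⟨-, hz⟩ hzc
    exact hz (by simp [sub_eq_zero.1 hzc, mem_reProdIm, hR, hD])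
  have hinv : ContinuousOn (fun z : ℂ => g c * (z - c)⁻¹) (rectBoundary (c - R) (c + R) D) :=
    continuousOn_const.mul (ContinuousOn.inv₀ (by fun_prop) hne)
  have split : EqOn (fun z => g z / (z - c)) (fun z => dslope g c z + g c * (z - c)⁻¹)
      (rectBoundary (c - R) (c + R) D) := fun z hz => by
    have := hne z hz
    simp only [dslope_of_ne _ (sub_ne_zero.1 this), slope_def_field]
    field_simp
    ring
  rw [rectIntegral_congr hab hD.le split, rectIntegral_add hab hD.le
    (hslope.continuousOn.mono sdiff_subset) hinv,
    rectIntegral_const_mul, rectIntegral_comp_sub (fun z => z⁻¹), sub_sub_cancel_left,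
    add_sub_cancel_left, rectIntegral_inv hR hD, rectIntegral_eq_zero
    (by rwa [uIcc_of_le hab, uIcc_of_le (neg_le_self hD.le)])]
  ring

theorem rectIntegral_add_adjacent
    (h₁ : Integrable fun x : ℝ => f (x + (-D : ℝ) * I))
    (h₂ : Integrable fun x : ℝ => f (x + D * I)) :
    rectIntegral f a b D + rectIntegral f b c D = rectIntegral f a c D := by
  simp only [rectIntegral]
  rw [← intervalIntegral.integral_add_adjacent_intervals (a := a) (b := b) (c := c)
    h₁.intervalIntegrable h₁.intervalIntegrable,
    ← intervalIntegral.integral_add_adjacent_intervals (a := a) (b := b) (c := c)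
    h₂.intervalIntegrable h₂.intervalIntegrable]
  ring

theorem sum_rectIntegral_columns (h₁ : Integrable fun x : ℝ => f (x + (-D : ℝ) * I))
    (h₂ : Integrable fun x : ℝ => f (x + D * I)) (m : ℕ) :
    ∑ k ∈ Finset.Icc (-(m : ℤ)) m, rectIntegral f (k * h - h / 2) (k * h + h / 2) D =
      rectIntegral f (-(m * h + h / 2)) (m * h + h / 2) D := by
  induction m with
  | zero => simp
  | succ m ih =>
    have hdisj : Disjoint (Finset.Icc (-(m : ℤ)) m) {(-(m + 1) : ℤ), (m + 1 : ℤ)} := by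
      simp only [Finset.disjoint_left, Finset.mem_Icc, Finset.mem_insert, Finset.mem_singleton]
      omega
    have hne : (-(m + 1) : ℤ) ≠ (m + 1 : ℤ) := by omega
    have left : rectIntegral f ((-(m + 1) : ℤ) * h - h / 2) ((-(m + 1) : ℤ) * h + h / 2) D =
        rectIntegral f (-((m + 1) * h + h / 2)) (-(m * h + h / 2)) D := by
      congr 1 <;> push_cast <;> ring
    have right : rectIntegral f ((m + 1 : ℤ) * h - h / 2) ((m + 1 : ℤ) * h + h / 2) D =
        rectIntegral f (m * h + h / 2) ((m + 1) * h + h / 2) D := by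
      congr 1 <;> push_cast <;> ring
    push_cast
    rw [Finset.Icc_succ_succ, Finset.sum_union hdisj, ih, Finset.sum_pair hne, left, right,
      add_left_comm, rectIntegral_add_adjacent h₁ h₂, rectIntegral_add_adjacent h₁ h₂]

theorem tendsto_rectIntegral {ι : Type*} {l : Filter ι} [l.IsCountablyGenerated] {a b ea eb : ι → ℝ}
    (hD : 0 ≤ D) (h₁ : Integrable fun x : ℝ => f (x + (-D : ℝ) * I))
    (h₂ : Integrable fun x : ℝ => f (x + D * I)) (ha : Tendsto a l atBot) (hb : Tendsto b l atTop)
    (hea : Tendsto ea l (𝓝 0)) (heb : Tendsto eb l (𝓝 0))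
    (hfa : ∀ᶠ i in l, ∀ y : ℝ, |y| ≤ D → ‖f (a i + y * I)‖ ≤ ea i)
    (hfb : ∀ᶠ i in l, ∀ y : ℝ, |y| ≤ D → ‖f (b i + y * I)‖ ≤ eb i) :
    Tendsto (fun i => rectIntegral f (a i) (b i) D) l
      (𝓝 (stripIntegral f D)) := by
  have vertical {c e : ι → ℝ} (he : Tendsto e l (𝓝 0))
      (hfc : ∀ᶠ i in l, ∀ y : ℝ, |y| ≤ D → ‖f (c i + y * I)‖ ≤ e i) :
      Tendsto (fun i => I * ∫ y in (-D)..D, f (c i + y * I)) l (𝓝 0) := by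
    have hlim : Tendsto (fun i => e i * |D - -D|) l (𝓝 0) := by
      simpa using he.mul_const |D - -D|
    refine squeeze_zero_norm' ?_ hlim
    filter_upwards [hfc] with i hi
    rw [norm_mul, norm_I, one_mul]
    refine intervalIntegral.norm_integral_le_of_norm_le_const fun y hy => hi y ?_
    rw [uIoc_of_le (neg_le_self hD)] at hy
    exact abs_le.2 ⟨hy.1.le, hy.2⟩
  simpa [rectIntegral, stripIntegral] using (((intervalIntegral_tendsto_integral h₁ ha hb).sub
    (intervalIntegral_tendsto_integral h₂ ha hb)).add (vertical heb hfb)).sub (vertical hea hfa)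

end Rectangle

section StripDecay

/-- `F` is holomorphic on the closed strip `|Im z| ≤ D`, where it is dominated by the integrable
function `g` of the real part, which vanishes at infinity. -/
structure StripDecay (F : ℂ → ℂ) (D : ℝ) (g : ℝ → ℝ) : Prop where
  pos : 0 < D
  differentiableAt : ∀ z : ℂ, |z.im| ≤ D → DifferentiableAt ℂ F z
  norm_le : ∀ t y : ℝ, |y| ≤ D → ‖F (t + y * I)‖ ≤ g t
  integrable : Integrable g
  tendsto_zero : Tendsto g (cocompact ℝ) (𝓝 0)

namespace StripDecay

variable {F : ℂ → ℂ} {D : ℝ} {g : ℝ → ℝ}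

theorem abs_eq (H : StripDecay F D g) : |D| = D := abs_of_pos H.pos

theorem abs_neg_eq (H : StripDecay F D g) : |-D| = D := by rw [abs_neg, H.abs_eq]

theorem ne_zero_of_abs_eq (H : StripDecay F D g) {y : ℝ} (hy : |y| = D) : y ≠ 0 :=
  abs_pos.1 (hy ▸ H.pos)

theorem tendsto_zero_comp (H : StripDecay F D g) {ι : Type*} {l : Filter ι} {a : ι → ℝ}
    (ha : Tendsto a l atTop ∨ Tendsto a l atBot) : Tendsto (fun i => g (a i)) l (𝓝 0) :=
  H.tendsto_zero.comp <| ha.elim (·.mono_right atTop_le_cocompact) (·.mono_right atBot_le_cocompact)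

theorem continuous_line (H : StripDecay F D g) {y : ℝ} (hy : |y| ≤ D) :
    Continuous fun t : ℝ => F (t + y * I) :=
  continuous_iff_continuousAt.2 fun t =>
    (H.differentiableAt (t + y * I) (by simpa using hy)).continuousAt.comp
      (f := fun t : ℝ => (t : ℂ) + y * I) (by fun_prop)

theorem integrable_line (H : StripDecay F D g) {y : ℝ} (hy : |y| ≤ D) :
    Integrable fun t : ℝ => F (t + y * I) :=
  H.integrable.mono' (H.continuous_line hy).aestronglyMeasurable
    (.of_forall fun t => H.norm_le t y hy)

theorem integrable_line_mul (H : StripDecay F D g) {y C : ℝ} (hy : |y| ≤ D) {k : ℝ → ℂ}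
    (hk : Continuous k) (hC : ∀ t, ‖k t‖ ≤ C) : Integrable fun t : ℝ => F (t + y * I) * k t :=
  (H.integrable_line hy).mul_bdd hk.aestronglyMeasurable (.of_forall hC)

theorem continuous_ofReal (H : StripDecay F D g) : Continuous fun t : ℝ => F t := by
  simpa using H.continuous_line (y := 0) (by simpa using H.pos.le)

theorem integrable_ofReal (H : StripDecay F D g) : Integrable fun t : ℝ => F t := by
  simpa using H.integrable_line (y := 0) (by simpa using H.pos.le)

end StripDecay

theorem sub_ofReal_ne_zero {y : ℝ} (hy : y ≠ 0) (t x : ℝ) : (t : ℂ) + y * I - x ≠ 0 := fun h =>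
  hy (by simpa using congrArg im h)

theorem abs_im_le_norm_sub (t y x : ℝ) : |y| ≤ ‖(t : ℂ) + y * I - x‖ := by
  simpa using abs_im_le_norm ((t : ℂ) + y * I - x)

theorem abs_re_sub_le_norm (t y x : ℝ) : |t - x| ≤ ‖(t : ℂ) + y * I - x‖ := by
  simpa using abs_re_le_norm ((t : ℂ) + y * I - x)

namespace StripDecay

variable {F : ℂ → ℂ} {D : ℝ} {g : ℝ → ℝ}

theorem integrable_mul_inv_sub (H : StripDecay F D g) {y : ℝ} (hy : |y| = D) (x : ℝ) :
    Integrable fun t : ℝ => F (t + y * I) * (t + y * I - x)⁻¹ := by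
  have hy₀ := H.ne_zero_of_abs_eq hy
  refine H.integrable_line_mul (C := |y|⁻¹) hy.le
    (Continuous.inv₀ (by fun_prop) fun t => sub_ofReal_ne_zero hy₀ t x) fun t => ?_
  rw [norm_inv]
  exact inv_anti₀ (abs_pos.2 hy₀) (abs_im_le_norm_sub t y x)

theorem stripIntegral_mul_inv_sub (H : StripDecay F D g) (x : ℝ) :
    stripIntegral (fun z => F z * (z - x)⁻¹) D = 2 * Real.pi * I * F x := by
  have htop : Tendsto (fun R : ℝ => x + R) atTop atTop :=
    tendsto_atTop_add_const_left _ _ tendsto_id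
  have hbot : Tendsto (fun R : ℝ => x - R) atTop atBot :=
    tendsto_atBot_add_const_left _ _ tendsto_neg_atTop_atBot
  have vertical {u : ℝ} (hu : 1 ≤ |u - x|) (y : ℝ) (hy : |y| ≤ D) :
      ‖F (u + y * I) * (u + y * I - x)⁻¹‖ ≤ g u := by
    rw [norm_mul, norm_inv, ← div_eq_mul_inv]
    exact (div_le_self (norm_nonneg _) (hu.trans (abs_re_sub_le_norm u y x))).trans
      (H.norm_le u y hy)
  have limit := tendsto_rectIntegral (f := fun z => F z * (z - x)⁻¹) H.pos.le
    (H.integrable_mul_inv_sub H.abs_neg_eq x) (H.integrable_mul_inv_sub H.abs_eq x) hbot htop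
    (H.tendsto_zero_comp (.inr hbot)) (H.tendsto_zero_comp (.inl htop))
    (by filter_upwards [eventually_ge_atTop 1] with R hR using
      vertical (by rwa [sub_sub_cancel_left, abs_neg, abs_of_nonneg (by linarith)]))
    (by filter_upwards [eventually_ge_atTop 1] with R hR using
      vertical (by rwa [add_sub_cancel_left, abs_of_nonneg (by linarith)]))
  refine tendsto_nhds_unique_of_eventuallyEq limit tendsto_const_nhds ?_
  filter_upwards [eventually_gt_atTop 0] with R hR
  exact rectIntegral_div_sub hR H.pos fun z hz =>
    (H.differentiableAt z (abs_le.2 ⟨hz.2.1, hz.2.2⟩)).differentiableWithinAt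

end StripDecay

end StripDecay

section NodeSine

variable {h x : ℝ} {z : ℂ}

theorem norm_sin_add_mul_I_sq (a b : ℝ) :
    ‖Complex.sin (a + b * I)‖ ^ 2 = Real.sin a ^ 2 + Real.sinh b ^ 2 := by
  have cartesian : Complex.sin (a + b * I) =
      (Real.sin a * Real.cosh b : ℝ) + (Real.cos a * Real.sinh b : ℝ) * I := by
    rw [Complex.sin_add_mul_I]
    push_cast
    ring
  rw [cartesian, ← normSq_eq_norm_sq, normSq_add_mul_I, mul_pow, mul_pow, Real.cosh_sq]
  linear_combination Real.sinh b ^ 2 * Real.sin_sq_add_cos_sq a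

theorem abs_sinh_le_norm_sin (a b : ℝ) : |Real.sinh b| ≤ ‖Complex.sin (a + b * I)‖ :=
  abs_le_of_sq_le_sq (by nlinarith [norm_sin_add_mul_I_sq a b, sq_nonneg (Real.sin a)])
    (norm_nonneg _)

theorem one_le_norm_sin {a : ℝ} (ha : Real.cos a = 0) (b : ℝ) :
    1 ≤ ‖Complex.sin (a + b * I)‖ := by
  refine (one_le_sq_iff₀ (norm_nonneg _)).1 ?_
  rw [norm_sin_add_mul_I_sq, Real.sin_sq, ha]
  nlinarith [sq_nonneg (Real.sinh b)]

theorem cos_int_mul_pi_ne_zero (k : ℤ) : Real.cos (k * Real.pi) ≠ 0 := fun h₀ => by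
  simpa [h₀] using Real.sin_sq_add_cos_sq (k * Real.pi)

theorem cos_half_node (hh : h ≠ 0) (m : ℕ) : Real.cos (Real.pi / h * (m * h + h / 2)) = 0 := by
  rw [show Real.pi / h * (m * h + h / 2) = m * Real.pi + Real.pi / 2 by field_simp,
    Real.cos_add_pi_div_two, Real.sin_nat_mul_pi, neg_zero]

/-- The function `sin (π z / h)`, which vanishes exactly at the nodes `k h`. -/
noncomputable def nodeSin (h : ℝ) (z : ℂ) : ℂ := Complex.sin (Real.pi / h * z)

theorem differentiable_nodeSin (h : ℝ) : Differentiable ℂ (nodeSin h) := by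
  unfold nodeSin
  fun_prop

theorem nodeSin_add_mul_I (h t y : ℝ) : nodeSin h (t + y * I) =
    Complex.sin ((Real.pi / h * t : ℝ) + (Real.pi / h * y : ℝ) * I) := by
  rw [nodeSin]
  congr 1
  push_cast
  ring

theorem nodeSin_ofReal (h x : ℝ) : nodeSin h x = (Real.sin (Real.pi / h * x) : ℝ) := by
  rw [nodeSin]
  push_cast
  rfl

theorem norm_nodeSin_ofReal_le (h x : ℝ) : ‖nodeSin h x‖ ≤ 1 := by
  rw [nodeSin_ofReal, norm_real]
  exact Real.abs_sin_le_one _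

theorem abs_sinh_le_norm_nodeSin (h t y : ℝ) :
    |Real.sinh (Real.pi / h * y)| ≤ ‖nodeSin h (t + y * I)‖ := by
  rw [nodeSin_add_mul_I]
  exact abs_sinh_le_norm_sin _ _

theorem abs_sinh_pos (hh : h ≠ 0) {y : ℝ} (hy : y ≠ 0) : 0 < |Real.sinh (Real.pi / h * y)| :=
  abs_pos.2 (Real.sinh_ne_zero.2 (by positivity))

theorem nodeSin_add_mul_I_ne_zero (hh : h ≠ 0) {y : ℝ} (hy : y ≠ 0) (t : ℝ) :
    nodeSin h (t + y * I) ≠ 0 :=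
  norm_pos_iff.1 ((abs_sinh_pos hh hy).trans_le (abs_sinh_le_norm_nodeSin h t y))

theorem nodeSin_eq_zero_iff (hh : h ≠ 0) : nodeSin h z = 0 ↔ ∃ k : ℤ, z = (k * h : ℝ) := by
  rw [nodeSin, Complex.sin_eq_zero_iff]
  have hh' : (h : ℂ) ≠ 0 := ofReal_ne_zero.2 hh
  have hπ : (Real.pi : ℂ) ≠ 0 := ofReal_ne_zero.2 Real.pi_ne_zero
  refine exists_congr fun k => ?_
  push_cast
  rw [div_mul_eq_mul_div, div_eq_iff hh', mul_comm (Real.pi : ℂ) z, mul_right_comm,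
    mul_left_inj' hπ]

theorem nodeSin_node (hh : h ≠ 0) (k : ℤ) : nodeSin h (k * h : ℝ) = 0 :=
  (nodeSin_eq_zero_iff hh).2 ⟨k, rfl⟩

theorem deriv_nodeSin_node (hh : h ≠ 0) (k : ℤ) :
    deriv (nodeSin h) (k * h : ℝ) = (Real.pi / h * Real.cos (k * Real.pi) : ℝ) := by
  have scale : HasDerivAt (fun z : ℂ => (Real.pi / h : ℂ) * z) (Real.pi / h) (k * h : ℝ) := by
    simpa using (hasDerivAt_id _).const_mul (Real.pi / h : ℂ)
  have hh' : (h : ℂ) ≠ 0 := ofReal_ne_zero.2 hh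
  rw [HasDerivAt.deriv (f := nodeSin h) scale.csin, mul_comm]
  push_cast
  congr 2
  field_simp

theorem deriv_nodeSin_node_ne_zero (hh : h ≠ 0) (k : ℤ) : deriv (nodeSin h) (k * h : ℝ) ≠ 0 := by
  rw [deriv_nodeSin_node hh]
  exact ofReal_ne_zero.2
    (mul_ne_zero (div_ne_zero Real.pi_ne_zero hh) (cos_int_mul_pi_ne_zero k))

theorem differentiable_dslope_nodeSin (h : ℝ) (c : ℂ) : Differentiable ℂ (dslope (nodeSin h) c) :=
  differentiableOn_univ.1 <|
    (differentiableOn_dslope univ_mem).2 (differentiable_nodeSin h).differentiableOn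

theorem dslope_nodeSin_node_ne_zero (hh : 0 < h) {k : ℤ} (hz : |z.re - k * h| < h) :
    dslope (nodeSin h) (k * h : ℝ) z ≠ 0 := by
  by_cases hzk : z = (k * h : ℝ)
  · rw [hzk, dslope_same]
    exact deriv_nodeSin_node_ne_zero hh.ne' k
  · rw [dslope_of_ne _ hzk, slope_def_field, nodeSin_node hh.ne', sub_zero]
    refine div_ne_zero (fun hz₀ => hzk ?_) (sub_ne_zero.2 hzk)
    obtain ⟨j, rfl⟩ := (nodeSin_eq_zero_iff hh.ne').1 hz₀
    have hjk : |((j - k : ℤ) : ℝ)| < 1 := by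
      rw [ofReal_re, ← sub_mul, abs_mul, abs_of_pos hh] at hz
      push_cast
      exact lt_of_mul_lt_mul_right (by rwa [one_mul]) hh.le
    have hj : |j - k| < 1 := by exact_mod_cast hjk
    rw [sub_eq_zero.1 (Int.abs_lt_one_iff.1 hj)]

theorem sinc_node_eq (hh : h ≠ 0) {k : ℤ} (hx : x ≠ k * h) :
    Real.sinc (Real.pi * (x / h - k)) =
      h * Real.sin (Real.pi / h * x) * Real.cos (k * Real.pi) / (Real.pi * (x - k * h)) := by
  have hsub : x / h - k = (x - k * h) / h := by field_simp
  have hπ := Real.pi_ne_zero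
  have : x - k * h ≠ 0 := sub_ne_zero.2 hx
  have hsin : Real.sin (Real.pi * (x / h - k)) =
      Real.sin (Real.pi / h * x) * Real.cos (k * Real.pi) := by
    rw [show Real.pi * (x / h - k) = Real.pi / h * x - k * Real.pi by ring, Real.sin_sub,
      Real.sin_int_mul_pi, mul_zero, sub_zero]
  rw [Real.sinc_of_ne_zero (by rw [hsub]; positivity), hsin, hsub]
  field_simp

theorem dslope_nodeSin_div_deriv (hh : h ≠ 0) (k : ℤ) (x : ℝ) :
    dslope (nodeSin h) x (k * h : ℝ) / deriv (nodeSin h) (k * h : ℝ) =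
      (Real.sinc (Real.pi * (x / h - k)) : ℝ) := by
  by_cases hx : x = k * h
  · rw [hx, dslope_same, div_self (deriv_nodeSin_node_ne_zero hh k), mul_div_cancel_right₀ _ hh,
      sub_self, mul_zero, Real.sinc_zero, ofReal_one]
  · have : x - k * h ≠ 0 := sub_ne_zero.2 hx
    have hc := cos_int_mul_pi_ne_zero k
    have hc₂ : Real.cos (k * Real.pi) ^ 2 = 1 := by
      simpa using Real.sin_sq_add_cos_sq (k * Real.pi)
    rw [dslope_of_ne _ (ofReal_injective.ne (Ne.symm hx)), slope_def_field, nodeSin_node hh,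
      deriv_nodeSin_node hh, nodeSin_ofReal, sinc_node_eq hh hx, zero_sub, ← ofReal_sub,
      ← neg_sub x, ofReal_neg, neg_div_neg_eq]
    norm_cast
    have := Real.pi_ne_zero
    rw [div_div, div_eq_div_iff (by positivity) (by positivity)]
    have hh₁ : Real.pi / h * h = Real.pi := div_mul_cancel₀ _ hh
    linear_combination (-Real.sin (Real.pi / h * x) * Real.pi * (x - k * h)) * hc₂ -
      Real.sin (Real.pi / h * x) * Real.cos (k * Real.pi) ^ 2 * (x - k * h) * hh₁

/-- The kernel `(1 - sin (π x / h) / sin (π z / h)) / (z - x)` with its removable singularity at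
`z = x` filled in: its only poles are at the nodes, and the residues are the values of the cardinal
functions at `x`. -/
noncomputable def sincKernel (h x : ℝ) (z : ℂ) : ℂ := dslope (nodeSin h) x z / nodeSin h z

theorem sincKernel_eq (hz : z - x ≠ 0) (hs : nodeSin h z ≠ 0) :
    sincKernel h x z = (z - x)⁻¹ - (nodeSin h z)⁻¹ * (nodeSin h x * (z - x)⁻¹) := by
  rw [sincKernel, dslope_of_ne _ (sub_ne_zero.1 hz), slope_def_field]
  field_simp

theorem norm_sincKernel_le {δ s : ℝ} (hδ : 0 < δ) (hs : 0 < s) (hδz : δ ≤ ‖z - x‖)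
    (hsz : s ≤ ‖nodeSin h z‖) : ‖sincKernel h x z‖ ≤ δ⁻¹ * (1 + s⁻¹) := by
  rw [sincKernel_eq (norm_pos_iff.1 (hδ.trans_le hδz)) (norm_pos_iff.1 (hs.trans_le hsz))]
  calc _ ≤ ‖z - x‖⁻¹ + ‖nodeSin h z‖⁻¹ * (‖nodeSin h x‖ * ‖z - x‖⁻¹) :=
        (norm_sub_le _ _).trans_eq (by simp only [norm_mul, norm_inv])
    _ ≤ δ⁻¹ + s⁻¹ * (1 * δ⁻¹) := by
        gcongr
        exact norm_nodeSin_ofReal_le h x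
    _ = _ := by ring

end NodeSine

namespace StripDecay

variable {F : ℂ → ℂ} {D h : ℝ} {g : ℝ → ℝ}

theorem integrable_mul_sincKernel (H : StripDecay F D g) (hh : h ≠ 0) {y : ℝ} (hy : |y| = D)
    (x : ℝ) : Integrable fun t : ℝ => F (t + y * I) * sincKernel h x (t + y * I) := by
  have hy₀ := H.ne_zero_of_abs_eq hy
  refine H.integrable_line_mul (C := |y|⁻¹ * (1 + |Real.sinh (Real.pi / h * y)|⁻¹)) hy.le
    (Continuous.div
    ((differentiable_dslope_nodeSin h x).continuous.comp (by fun_prop))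
    ((differentiable_nodeSin h).continuous.comp (by fun_prop)) fun t =>
      nodeSin_add_mul_I_ne_zero hh hy₀ t) fun t => ?_
  exact norm_sincKernel_le (abs_pos.2 hy₀) (abs_sinh_pos hh hy₀) (abs_im_le_norm_sub t y x)
    (abs_sinh_le_norm_nodeSin h t y)

theorem norm_mul_sincKernel_le (H : StripDecay F D g) {u x : ℝ}
    (hu : Real.cos (Real.pi / h * u) = 0) (hux : 1 ≤ |u - x|) (y : ℝ) (hy : |y| ≤ D) :
    ‖F (u + y * I) * sincKernel h x (u + y * I)‖ ≤ g u * 2 := by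
  have kernel : ‖sincKernel h x (u + y * I)‖ ≤ 1⁻¹ * (1 + 1⁻¹) :=
    norm_sincKernel_le one_pos one_pos (hux.trans (abs_re_sub_le_norm u y x))
      (nodeSin_add_mul_I h u y ▸ one_le_norm_sin hu _)
  rw [norm_mul]
  exact mul_le_mul (H.norm_le u y hy) (by linarith) (norm_nonneg _)
    ((norm_nonneg _).trans (H.norm_le u y hy))

theorem rectIntegral_mul_sincKernel (H : StripDecay F D g) (hh : 0 < h) (k : ℤ) (x : ℝ) :
    rectIntegral (fun z => F z * sincKernel h x z) (k * h - h / 2) (k * h + h / 2) D =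
      2 * Real.pi * I * (F (k * h : ℝ) * (Real.sinc (Real.pi * (x / h - k)) : ℝ)) := by
  have hregular : ∀ z ∈ Icc (k * h - h / 2) (k * h + h / 2) ×ℂ Icc (-D) D,
      dslope (nodeSin h) (k * h : ℝ) z ≠ 0 := fun z hz =>
    dslope_nodeSin_node_ne_zero hh <|
      abs_lt.2 ⟨by linarith [hz.1.1], by linarith [hz.1.2]⟩
  have residue := rectIntegral_div_sub
    (g := fun z => F z * (dslope (nodeSin h) x z / dslope (nodeSin h) (k * h : ℝ) z))
    (half_pos hh) H.pos fun z hz => DifferentiableAt.differentiableWithinAt <|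
      (H.differentiableAt z (abs_le.2 ⟨hz.2.1, hz.2.2⟩)).mul <|
        (differentiable_dslope_nodeSin h _ z).div (differentiable_dslope_nodeSin h _ z)
          (hregular z hz)
  rw [dslope_same (nodeSin h) (k * h : ℝ), dslope_nodeSin_div_deriv hh.ne'] at residue
  rw [← residue]
  refine rectIntegral_congr (by linarith) H.pos.le fun z hz => ?_
  have hzk : z ≠ (k * h : ℝ) := by
    rintro rfl
    exact hz.2 (by simp [mem_reProdIm, hh, H.pos])
  have hzk' := sub_ne_zero.2 hzk
  have hne := hregular z hz.1
  rw [dslope_of_ne _ hzk, slope_def_field, nodeSin_node hh.ne', sub_zero] at hne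
  have hs : nodeSin h z ≠ 0 := (div_ne_zero_iff.1 hne).1
  simp only [sincKernel, dslope_of_ne _ hzk, slope_def_field, nodeSin_node hh.ne', sub_zero]
  field_simp

theorem stripIntegral_mul_sincKernel (H : StripDecay F D g) (hh : 0 < h)
    (hs : Summable fun k : ℤ => F (k * h : ℝ)) (x : ℝ) :
    stripIntegral (fun z => F z * sincKernel h x z) D = 2 * Real.pi * I *
      ∑' k : ℤ, F (k * h : ℝ) * (Real.sinc (Real.pi * (x / h - k)) : ℝ) := by
  have htop : Tendsto (fun m : ℕ => (m : ℝ) * h + h / 2) atTop atTop :=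
    tendsto_atTop_add_const_right _ _ (tendsto_natCast_atTop_atTop.atTop_mul_const hh)
  have hbot : Tendsto (fun m : ℕ => -((m : ℝ) * h + h / 2)) atTop atBot :=
    tendsto_neg_atTop_atBot.comp htop
  have hneg := H.integrable_mul_sincKernel hh.ne' H.abs_neg_eq x
  have hpos := H.integrable_mul_sincKernel hh.ne' H.abs_eq x
  have limit := tendsto_rectIntegral (f := fun z => F z * sincKernel h x z) H.pos.le hneg hpos
    hbot htop
    (by simpa only [zero_mul] using (H.tendsto_zero_comp (.inr hbot)).mul_const 2)
    (by simpa only [zero_mul] using (H.tendsto_zero_comp (.inl htop)).mul_const 2)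
    (by
      filter_upwards [hbot.eventually (eventually_le_atBot (x - 1))] with m hm
      refine H.norm_mul_sincKernel_le (by rw [mul_neg, Real.cos_neg, cos_half_node hh.ne']) ?_
      exact le_trans (by linarith) (neg_le_abs _))
    (by
      filter_upwards [htop.eventually (eventually_ge_atTop (x + 1))] with m hm
      exact H.norm_mul_sincKernel_le (cos_half_node hh.ne' m)
        (le_trans (by linarith) (le_abs_self _)))
  have hsum : Summable fun k : ℤ => F (k * h : ℝ) * (Real.sinc (Real.pi * (x / h - k)) : ℝ) :=
    Summable.of_norm_bounded hs.norm fun k => by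
      rw [norm_mul, norm_real]
      exact mul_le_of_le_one_right (norm_nonneg _) (Real.abs_sinc_le_one _)
  refine tendsto_nhds_unique (limit.congr fun m => ?_)
    ((hsum.hasSum.comp (Finset.tendsto_Icc_neg (R := ℤ))).const_mul (2 * Real.pi * I))
  rw [Function.comp, ← sum_rectIntegral_columns hneg hpos, Finset.mul_sum]
  exact Finset.sum_congr rfl fun k _ => H.rectIntegral_mul_sincKernel hh k x

theorem sinc_interpolation_error (H : StripDecay F D g) (hh : 0 < h)
    (hs : Summable fun k : ℤ => F (k * h : ℝ)) (x : ℝ) :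
    2 * Real.pi * I *
        (F x - ∑' k : ℤ, F (k * h : ℝ) * (Real.sinc (Real.pi * (x / h - k)) : ℝ)) =
      stripIntegral (fun z => F z * (nodeSin h z)⁻¹ * (nodeSin h x * (z - x)⁻¹)) D := by
  have line {y : ℝ} (hy : |y| = D) :
      ∫ t : ℝ, F (t + y * I) * (nodeSin h (t + y * I))⁻¹ * (nodeSin h x * (t + y * I - x)⁻¹) =
        (∫ t : ℝ, F (t + y * I) * (t + y * I - x)⁻¹) -
          ∫ t : ℝ, F (t + y * I) * sincKernel h x (t + y * I) := by
    rw [← integral_sub (H.integrable_mul_inv_sub hy x)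
      (H.integrable_mul_sincKernel hh.ne' hy x)]
    congr 1 with t
    have hy₀ := H.ne_zero_of_abs_eq hy
    rw [sincKernel_eq (sub_ofReal_ne_zero hy₀ t x) (nodeSin_add_mul_I_ne_zero hh.ne' hy₀ t)]
    ring
  rw [mul_sub, ← H.stripIntegral_mul_inv_sub, ← H.stripIntegral_mul_sincKernel hh hs,
    stripIntegral, stripIntegral, stripIntegral, line H.abs_neg_eq, line H.abs_eq]
  ring

end StripDecay

section SineIntegral

variable {x : ℝ}

/-- The integrand of the Laplace-type representation of `π / 2 - Si x`. Its derivative with respect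
to `x` is `-exp (-(x * t)) * sin x`, whose integral over `t > 0` is `-sinc x`. -/
noncomputable def siTailKernel (x t : ℝ) : ℝ :=
  Real.exp (-(x * t)) * (Real.cos x + t * Real.sin x) * (1 + t ^ 2)⁻¹

/-- The Laplace-type representation of `π / 2 - Si x`. -/
noncomputable def siTail (x : ℝ) : ℝ := ∫ t in Ioi (0 : ℝ), siTailKernel x t

theorem continuous_siTailKernel (x : ℝ) : Continuous (siTailKernel x) := by
  unfold siTailKernel
  exact Continuous.mul (by fun_prop) (Continuous.inv₀ (by fun_prop) fun t => by positivity)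

theorem abs_siTailKernel_le (x t : ℝ) : |siTailKernel x t| ≤ Real.exp (-(x * t)) := by
  have amplitude : |Real.cos x + t * Real.sin x| ≤ 1 + t ^ 2 := by
    refine abs_le_of_sq_le_sq ?_ (by positivity)
    nlinarith [Real.sin_sq_add_cos_sq x, sq_nonneg (t * Real.cos x - Real.sin x), sq_nonneg t,
      sq_nonneg (t ^ 2)]
  have hpos : 0 < 1 + t ^ 2 := by positivity
  rw [siTailKernel, abs_mul, abs_mul, Real.abs_exp, abs_of_pos (inv_pos.2 hpos), mul_assoc,
    ← div_eq_mul_inv]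
  exact mul_le_of_le_one_right (Real.exp_pos _).le ((div_le_one hpos).2 amplitude)

theorem integrableOn_exp_neg_mul (hx : 0 < x) :
    IntegrableOn (fun t => Real.exp (-(x * t))) (Ioi 0) := by
  simpa only [neg_mul] using integrableOn_exp_mul_Ioi (neg_lt_zero.2 hx) 0

theorem integral_exp_neg_mul (hx : 0 < x) : ∫ t in Ioi (0 : ℝ), Real.exp (-(x * t)) = x⁻¹ := by
  simpa [neg_div] using integral_exp_mul_Ioi (neg_lt_zero.2 hx) 0

theorem abs_siTail_le (hx : 0 < x) : |siTail x| ≤ x⁻¹ := by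
  rw [← integral_exp_neg_mul hx, siTail, ← Real.norm_eq_abs]
  exact norm_integral_le_of_norm_le (integrableOn_exp_neg_mul hx)
    (.of_forall fun t => abs_siTailKernel_le x t)

theorem hasDerivAt_siTailKernel (x t : ℝ) :
    HasDerivAt (fun x => siTailKernel x t) (-(Real.exp (-(x * t)) * Real.sin x)) x := by
  have hexp : HasDerivAt (fun x : ℝ => Real.exp (-(x * t))) (Real.exp (-(x * t)) * -(1 * t)) x :=
    ((hasDerivAt_id x).mul_const t).neg.exp
  have htrig : HasDerivAt (fun x : ℝ => Real.cos x + t * Real.sin x)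
      (-Real.sin x + t * Real.cos x) x :=
    (Real.hasDerivAt_cos x).add ((Real.hasDerivAt_sin x).const_mul t)
  refine ((hexp.mul htrig).mul_const (1 + t ^ 2)⁻¹).congr_deriv ?_
  have : 1 + t ^ 2 ≠ 0 := by positivity
  field_simp
  ring

theorem hasDerivAt_siTail (hx : 0 < x) : HasDerivAt siTail (-Real.sinc x) x := by
  have key := hasDerivAt_integral_of_dominated_loc_of_deriv_le
    (μ := volume.restrict (Ioi (0 : ℝ))) (F := siTailKernel)
    (F' := fun x t => -(Real.exp (-(x * t)) * Real.sin x)) (x₀ := x)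
    (bound := fun t => Real.exp (-(x / 2 * t))) (Ioi_mem_nhds (half_lt_self hx))
    (.of_forall fun x => (continuous_siTailKernel x).aestronglyMeasurable)
    ((integrableOn_exp_neg_mul hx).mono' (continuous_siTailKernel x).aestronglyMeasurable
      (.of_forall fun t => abs_siTailKernel_le x t))
    (Continuous.aestronglyMeasurable (by fun_prop))
    ((ae_restrict_mem measurableSet_Ioi).mono fun t ht y hy => by
      rw [norm_neg, norm_mul, Real.norm_eq_abs, Real.norm_eq_abs, Real.abs_exp]
      refine (mul_le_of_le_one_right (Real.exp_pos _).le (Real.abs_sin_le_one _)).trans ?_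
      have : 0 < t := ht
      have : x / 2 < y := hy
      gcongr)
    (integrableOn_exp_neg_mul (half_pos hx))
    (.of_forall fun t y _ => hasDerivAt_siTailKernel y t)
  refine key.2.congr_deriv ?_
  rw [integral_neg, integral_mul_const, integral_exp_neg_mul hx, Real.sinc_of_ne_zero hx.ne',
    div_eq_inv_mul]

theorem siTail_zero : siTail 0 = Real.pi / 2 := by simp [siTail, siTailKernel]

theorem abs_siTailKernel_le_inv_one_add_sq {t : ℝ} (hx : 0 ≤ x) (ht : 0 ≤ t) :
    |siTailKernel x t| ≤ (1 + t ^ 2)⁻¹ := by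
  have amplitude : |Real.cos x + t * Real.sin x| ≤ Real.exp (x * t) := by
    calc |Real.cos x + t * Real.sin x| ≤ 1 + t * x := by
          refine (abs_add_le _ _).trans (add_le_add (Real.abs_cos_le_one x) ?_)
          rw [abs_mul, abs_of_nonneg ht]
          gcongr
          exact Real.abs_sin_le_abs.trans_eq (abs_of_nonneg hx)
      _ ≤ Real.exp (x * t) := by linarith [Real.add_one_le_exp (x * t)]
  rw [siTailKernel, abs_mul, abs_mul, Real.abs_exp, Real.exp_neg,
    abs_of_pos (by positivity : 0 < (1 + t ^ 2)⁻¹)]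
  refine mul_le_of_le_one_left (by positivity) ?_
  rwa [inv_mul_le_iff₀ (Real.exp_pos _), mul_one]

theorem tendsto_siTail_zero : Tendsto siTail (𝓝[>] 0) (𝓝 (Real.pi / 2)) := by
  rw [← siTail_zero]
  refine tendsto_integral_filter_of_dominated_convergence (fun t => (1 + t ^ 2)⁻¹)
    (.of_forall fun x => (continuous_siTailKernel x).aestronglyMeasurable) ?_
    integrable_inv_one_add_sq.integrableOn (.of_forall fun t => ?_)
  · filter_upwards [self_mem_nhdsWithin] with x hx
    filter_upwards [ae_restrict_mem measurableSet_Ioi] with t ht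
    exact abs_siTailKernel_le_inv_one_add_sq (le_of_lt hx) (le_of_lt ht)
  · exact (hasDerivAt_siTailKernel 0 t).continuousAt.mono_left nhdsWithin_le_nhds

theorem hasDerivAt_Si (x : ℝ) : HasDerivAt Si (Real.sinc x) x :=
  Real.continuous_sinc.integral_hasStrictDerivAt 0 x |>.hasDerivAt

theorem Si_zero : Si 0 = 0 := intervalIntegral.integral_same

theorem Si_add_siTail (hx : 0 < x) : Si x + siTail x = Real.pi / 2 := by
  have deriv_zero : ∀ y ∈ Ioi (0 : ℝ), HasDerivAt (fun y => Si y + siTail y) 0 y := fun y hy =>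
    ((hasDerivAt_Si y).add (hasDerivAt_siTail hy)).congr_deriv (add_neg_cancel _)
  have constant : ∀ y ∈ Ioi (0 : ℝ), Si x + siTail x = Si y + siTail y := fun y hy =>
    isOpen_Ioi.is_const_of_deriv_eq_zero isPreconnected_Ioi
      (fun z hz => (deriv_zero z hz).differentiableAt.differentiableWithinAt)
      (fun z hz => (deriv_zero z hz).deriv) hx hy
  have limit : Tendsto (fun y => Si y + siTail y) (𝓝[>] 0) (𝓝 (Si 0 + Real.pi / 2)) :=
    ((hasDerivAt_Si 0).continuousAt.mono_left nhdsWithin_le_nhds).add tendsto_siTail_zero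
  rw [Si_zero, zero_add] at limit
  exact tendsto_nhds_unique_of_eventuallyEq tendsto_const_nhds limit
    (eventually_nhdsWithin_of_forall constant)

theorem Si_neg (x : ℝ) : Si (-x) = -Si x := by
  have reflect := intervalIntegral.integral_comp_neg (a := 0) (b := x) Real.sinc
  simp only [Real.sinc_neg, neg_zero] at reflect
  rw [Si, Si, reflect, intervalIntegral.integral_symm]

theorem tendsto_Si_atTop : Tendsto Si atTop (𝓝 (Real.pi / 2)) := by
  have tail : Tendsto siTail atTop (𝓝 0) := by
    refine squeeze_zero_norm' ?_ tendsto_inv_atTop_zero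
    filter_upwards [eventually_gt_atTop 0] with x hx using abs_siTail_le hx
  rw [← sub_zero (Real.pi / 2)]
  refine (tail.const_sub (Real.pi / 2)).congr' ?_
  filter_upwards [eventually_gt_atTop 0] with x hx
  rw [← Si_add_siTail hx, add_sub_cancel_right]

theorem tendsto_Si_atBot : Tendsto Si atBot (𝓝 (-(Real.pi / 2))) :=
  (tendsto_Si_atTop.comp tendsto_neg_atBot_atTop).neg.congr fun x => by
    rw [Function.comp, Si_neg, neg_neg]

theorem monotoneOn_Si : MonotoneOn Si (Icc 0 Real.pi) := by
  refine monotoneOn_of_deriv_nonneg (convex_Icc _ _)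
    (fun y _ => (hasDerivAt_Si y).continuousAt.continuousWithinAt)
    (fun y _ => (hasDerivAt_Si y).differentiableAt.differentiableWithinAt) fun y hy => ?_
  rw [interior_Icc] at hy
  rw [(hasDerivAt_Si y).deriv, Real.sinc_of_ne_zero hy.1.ne']
  exact div_nonneg (Real.sin_nonneg_of_nonneg_of_le_pi hy.1.le hy.2.le) hy.1.le

theorem Si_mem_Icc_of_pi_le (hx : Real.pi ≤ x) : Si x ∈ Icc 0 (Real.pi / 2 + Real.pi⁻¹) := by
  have hx₀ : 0 < x := Real.pi_pos.trans_le hx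
  have tail := abs_le.1 ((abs_siTail_le hx₀).trans (inv_anti₀ Real.pi_pos hx))
  have hπ : Real.pi⁻¹ ≤ Real.pi / 2 := by
    have : Real.pi⁻¹ ≤ 1 := inv_le_one_of_one_le₀ (by linarith [Real.pi_gt_three])
    linarith [Real.pi_gt_three]
  constructor <;> linarith [Si_add_siTail hx₀]

theorem Si_mem_Icc (hx : 0 ≤ x) : Si x ∈ Icc 0 (Real.pi / 2 + Real.pi⁻¹) := by
  rcases le_total Real.pi x with hπx | hπx
  · exact Si_mem_Icc_of_pi_le hπx
  · have hπ := Real.pi_pos.le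
    have lower := monotoneOn_Si (left_mem_Icc.2 hπ) ⟨hx, hπx⟩ hx
    have upper := monotoneOn_Si ⟨hx, hπx⟩ (right_mem_Icc.2 hπ) hπx
    exact ⟨Si_zero ▸ lower, upper.trans (Si_mem_Icc_of_pi_le le_rfl).2⟩

theorem abs_Si_le (x : ℝ) : |Si x| ≤ Real.pi / 2 + Real.pi⁻¹ := by
  rcases le_total 0 x with hx | hx
  · obtain ⟨lower, upper⟩ := Si_mem_Icc hx
    rwa [abs_of_nonneg lower]
  · obtain ⟨lower, upper⟩ := Si_mem_Icc (neg_nonneg.2 hx)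
    rw [Si_neg] at lower upper
    rwa [abs_of_nonpos (neg_nonneg.1 lower)]

end SineIntegral

section BasisFunctions

variable {h : ℝ}

theorem abs_J_le (k : ℤ) (hh : 0 ≤ h) (x : ℝ) : |J k h x| ≤ h * (1 + Real.pi⁻¹ ^ 2) := by
  rw [J, abs_mul, abs_of_nonneg hh]
  gcongr
  calc |1 / 2 + 1 / Real.pi * Si (Real.pi * (x / h - k))|
      ≤ 1 / 2 + 1 / Real.pi * (Real.pi / 2 + Real.pi⁻¹) := by
        refine (abs_add_le _ _).trans (add_le_add (abs_of_pos one_half_pos).le ?_)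
        rw [abs_mul, abs_of_pos (one_div_pos.2 Real.pi_pos)]
        gcongr
        exact abs_Si_le _
    _ = 1 + Real.pi⁻¹ ^ 2 := by
        field_simp
        ring

theorem tendsto_J_atBot (k : ℤ) (hh : 0 < h) : Tendsto (J k h) atBot (𝓝 0) := by
  have argument : Tendsto (fun x : ℝ => Real.pi * (x / h - k)) atBot atBot :=
    (tendsto_atBot_add_const_right _ (-(k : ℝ))
      (tendsto_id.atBot_div_const hh)).const_mul_atBot Real.pi_pos
  have limit : h * (1 / 2 + 1 / Real.pi * -(Real.pi / 2)) = 0 := by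
    have := Real.pi_ne_zero
    field_simp
    ring
  exact limit ▸
    (((tendsto_Si_atBot.comp argument).const_mul (1 / Real.pi)).const_add (1 / 2)).const_mul h

theorem hasDerivAt_J (k : ℤ) (hh : h ≠ 0) (x : ℝ) :
    HasDerivAt (J k h) (Real.sinc (Real.pi * (x / h - k))) x := by
  have argument : HasDerivAt (fun x : ℝ => Real.pi * (x / h - k)) (Real.pi * (1 / h)) x :=
    (((hasDerivAt_id x).div_const h).sub_const (k : ℝ)).const_mul Real.pi
  refine (((((hasDerivAt_Si _).comp x argument).const_mul (1 / Real.pi)).const_add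
    (1 / 2)).const_mul h).congr_deriv ?_
  have := Real.pi_ne_zero
  field_simp

theorem continuous_sinc_node (k : ℤ) (h : ℝ) :
    Continuous fun x => Real.sinc (Real.pi * (x / h - k)) :=
  Real.continuous_sinc.comp (by fun_prop)

theorem integral_sinc_node (k : ℤ) (hh : h ≠ 0) (a b : ℝ) :
    ∫ x in a..b, Real.sinc (Real.pi * (x / h - k)) = J k h b - J k h a :=
  intervalIntegral.integral_eq_sub_of_hasDerivAt (fun x _ => hasDerivAt_J k hh x)
    ((continuous_sinc_node k h).intervalIntegrable _ _)

theorem tendsto_tsum_mul_J {c : ℤ → ℂ} (hc : Summable c) (hh : 0 < h) (b : ℝ) {a : ℕ → ℝ}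
    (ha : Tendsto a atTop atBot) :
    Tendsto (fun m => ∑' k : ℤ, c k * (J k h b - J k h (a m) : ℝ)) atTop
      (𝓝 (∑' k : ℤ, c k * (J k h b : ℝ))) := by
  refine tendsto_tsum_of_dominated_convergence
    (bound := fun k : ℤ => ‖c k‖ *
      (h * (1 + Real.pi⁻¹ ^ 2) + h * (1 + Real.pi⁻¹ ^ 2)))
    (hc.norm.mul_right _) (fun k => ?_) (.of_forall fun m k => ?_)
  · have limit := ((tendsto_J_atBot k hh).comp ha).const_sub (J k h b)
    rw [sub_zero] at limit
    exact ((continuous_ofReal.tendsto _).comp limit).const_mul _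
  · rw [norm_mul, norm_real]
    gcongr
    exact norm_sub_le_of_le (abs_J_le k hh.le b) (abs_J_le k hh.le (a m))

end BasisFunctions

section OscillatoryIntegral

variable {h y : ℝ}

theorem integral_inv_sq_add_sub_sq_le (hy : y ≠ 0) (t a b : ℝ) :
    ∫ x in a..b, (y ^ 2 + (x - t) ^ 2)⁻¹ ≤ Real.pi / |y| := by
  rw [intervalIntegral.integral_comp_sub_right (fun x => (y ^ 2 + x ^ 2)⁻¹) t, ← sq_abs y,
    integral_inv_sq_add_sq (abs_ne_zero.2 hy), div_eq_inv_mul Real.pi]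
  gcongr
  linarith [Real.arctan_lt_pi_div_two ((b - t) / |y|),
    Real.neg_pi_div_two_lt_arctan ((a - t) / |y|)]

theorem norm_sub_ofReal_sq (t y x : ℝ) : ‖(t : ℂ) + y * I - x‖ ^ 2 = y ^ 2 + (x - t) ^ 2 := by
  have cartesian : (t : ℂ) + y * I - x = (t - x : ℝ) + y * I := by
    push_cast
    ring
  rw [cartesian, ← normSq_eq_norm_sq, normSq_add_mul_I]
  ring

theorem hasDerivAt_inv_sub_ofReal (hy : y ≠ 0) (t x : ℝ) :
    HasDerivAt (fun x : ℝ => ((t : ℂ) + y * I - x)⁻¹) (((t : ℂ) + y * I - x) ^ 2)⁻¹ x := by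
  have hsub : HasDerivAt (fun x : ℝ => (t : ℂ) + y * I - x) (-1) x := by
    simpa using (hasDerivAt_id x).ofReal_comp.const_sub ((t : ℂ) + y * I)
  refine (hsub.fun_inv (sub_ofReal_ne_zero hy t x)).congr_deriv ?_
  rw [neg_neg, one_div]

/-- The primitive of `nodeSin h` along the real line that vanishes where the cosine does. -/
noncomputable def nodeSinPrimitive (h x : ℝ) : ℂ :=
  (-(h / Real.pi * Real.cos (Real.pi / h * x)) : ℝ)

theorem hasDerivAt_nodeSinPrimitive (hh : h ≠ 0) (x : ℝ) :
    HasDerivAt (nodeSinPrimitive h) (nodeSin h x) x := by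
  rw [nodeSin_ofReal]
  have argument : HasDerivAt (fun x : ℝ => Real.pi / h * x) (Real.pi / h * 1) x :=
    (hasDerivAt_id x).const_mul _
  refine ((argument.cos.const_mul (h / Real.pi)).neg.congr_deriv ?_).ofReal_comp
  have := Real.pi_ne_zero
  field_simp

theorem norm_nodeSinPrimitive_le (hh : 0 ≤ h) (x : ℝ) : ‖nodeSinPrimitive h x‖ ≤ h / Real.pi := by
  have := Real.pi_pos
  rw [nodeSinPrimitive, norm_real, norm_neg, Real.norm_eq_abs, abs_mul,
    abs_of_nonneg (by positivity)]
  exact mul_le_of_le_one_right (by positivity) (Real.abs_cos_le_one _)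

theorem norm_integral_nodeSin_mul_inv_sub_le (hh : 0 < h) (hy : y ≠ 0) {a b : ℝ} (hab : a ≤ b)
    (ha : Real.cos (Real.pi / h * a) = 0) (t : ℝ) :
    ‖∫ x in a..b, nodeSin h x * ((t : ℂ) + y * I - x)⁻¹‖ ≤
      h / Real.pi * ((1 + Real.pi) / |y|) := by
  have : 0 < |y| := abs_pos.2 hy
  have hsq : Continuous fun x : ℝ => (((t : ℂ) + y * I - x) ^ 2)⁻¹ :=
    Continuous.inv₀ (by fun_prop) fun x => pow_ne_zero 2 (sub_ofReal_ne_zero hy t x)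
  have hkernel : Continuous fun x : ℝ => (y ^ 2 + (x - t) ^ 2)⁻¹ :=
    Continuous.inv₀ (by fun_prop) fun x => by positivity
  have hsin : Continuous fun x : ℝ => nodeSin h x :=
    (differentiable_nodeSin h).continuous.comp continuous_ofReal
  have by_parts := intervalIntegral.integral_mul_deriv_eq_deriv_mul (a := a) (b := b)
    (fun x _ => hasDerivAt_inv_sub_ofReal hy t x)
    (fun x _ => hasDerivAt_nodeSinPrimitive hh.ne' x)
    (hsq.intervalIntegrable _ _) (hsin.intervalIntegrable _ _)
  have hprimitive : nodeSinPrimitive h a = 0 := by simp [nodeSinPrimitive, ha]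
  have boundary : ‖((t : ℂ) + y * I - b)⁻¹ * nodeSinPrimitive h b‖ ≤ |y|⁻¹ * (h / Real.pi) := by
    rw [norm_mul, norm_inv]
    gcongr
    exacts [abs_im_le_norm_sub t y b, norm_nodeSinPrimitive_le hh.le b]
  have bulk : ‖∫ x in a..b, (((t : ℂ) + y * I - x) ^ 2)⁻¹ * nodeSinPrimitive h x‖ ≤
      Real.pi / |y| * (h / Real.pi) := by
    calc _ ≤ ∫ x in a..b, (y ^ 2 + (x - t) ^ 2)⁻¹ * (h / Real.pi) := by
          refine intervalIntegral.norm_integral_le_of_norm_le hab (.of_forall fun x _ => ?_)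
            ((hkernel.mul_const _).intervalIntegrable _ _)
          rw [norm_mul, norm_inv, norm_pow, norm_sub_ofReal_sq]
          gcongr
          exact norm_nodeSinPrimitive_le hh.le x
      _ ≤ _ := by
          rw [intervalIntegral.integral_mul_const]
          gcongr
          exact integral_inv_sq_add_sub_sq_le hy t a b
  simp only [mul_comm (nodeSin h _)]
  rw [by_parts, hprimitive, mul_zero, sub_zero]
  refine (norm_sub_le_of_le boundary bulk).trans_eq ?_
  field_simp

theorem norm_inv_nodeSin_le (hh : 0 < h) (hy : y ≠ 0) (t : ℝ) :
    ‖(nodeSin h (t + y * I))⁻¹‖ ≤ (Real.sinh (Real.pi / h * |y|))⁻¹ := by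
  have hpos := abs_sinh_pos hh.ne' hy
  have hle := abs_sinh_le_norm_nodeSin h t y
  rw [Real.abs_sinh, abs_mul, abs_of_pos (div_pos Real.pi_pos hh)] at hpos hle
  rw [norm_inv]
  exact inv_anti₀ hpos hle

end OscillatoryIntegral

/-- The norm `N₁` of a function on the closed strip `|Im z| ≤ D`: the sum of the `L¹` norms on the
two boundary lines. -/
noncomputable def stripNorm (F : ℂ → ℂ) (D : ℝ) : ℝ :=
  (∫ t : ℝ, ‖F (t + (-D : ℝ) * I)‖) + ∫ t : ℝ, ‖F (t + D * I)‖

theorem stripNorm_nonneg (F : ℂ → ℂ) (D : ℝ) : 0 ≤ stripNorm F D :=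
  add_nonneg (integral_nonneg fun _ => norm_nonneg _) (integral_nonneg fun _ => norm_nonneg _)

namespace StripDecay

variable {F : ℂ → ℂ} {D h y : ℝ} {g : ℝ → ℝ}

theorem integrable_mul_inv_nodeSin (H : StripDecay F D g) (hh : 0 < h) (hy : |y| = D) :
    Integrable fun t : ℝ => F (t + y * I) * (nodeSin h (t + y * I))⁻¹ :=
  have hy₀ := H.ne_zero_of_abs_eq hy
  H.integrable_line_mul hy.le (Continuous.inv₀
    ((differentiable_nodeSin h).continuous.comp (by fun_prop))
    fun t => nodeSin_add_mul_I_ne_zero hh.ne' hy₀ t) (norm_inv_nodeSin_le hh hy₀)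

theorem integrable_prod_nodeSin (H : StripDecay F D g) (hh : 0 < h) (hy : |y| = D) (a b : ℝ) :
    Integrable (Function.uncurry fun x t : ℝ =>
        F (t + y * I) * (nodeSin h (t + y * I))⁻¹ * (nodeSin h x * ((t : ℂ) + y * I - x)⁻¹))
      ((volume.restrict (uIoc a b)).prod volume) := by
  have hy₀ := H.ne_zero_of_abs_eq hy
  have hfinite : IsFiniteMeasure (volume.restrict (uIoc a b)) :=
    inferInstanceAs (IsFiniteMeasure (volume.restrict (Ioc _ _)))
  have hsin : Continuous fun x : ℝ => nodeSin h x :=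
    (differentiable_nodeSin h).continuous.comp Complex.continuous_ofReal
  have hprod := (integrable_const (μ := volume.restrict (uIoc a b)) (1 : ℂ)).mul_prod
    (H.integrable_mul_inv_nodeSin hh hy)
  simp only [one_mul] at hprod
  refine hprod.mul_bdd (c := 1 * |y|⁻¹) (Continuous.aestronglyMeasurable ?_)
    (.of_forall fun p => ?_)
  · exact (hsin.comp continuous_fst).mul
      (Continuous.inv₀ (by fun_prop) fun p => sub_ofReal_ne_zero hy₀ p.2 p.1)
  · rw [norm_mul, norm_inv]
    gcongr
    exacts [norm_nodeSin_ofReal_le h p.1, abs_im_le_norm_sub p.2 y p.1]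

theorem intervalIntegral_stripIntegral (H : StripDecay F D g) (hh : 0 < h) (a b : ℝ) :
    ∫ x in a..b, stripIntegral (fun z => F z * (nodeSin h z)⁻¹ * (nodeSin h x * (z - x)⁻¹)) D =
      stripIntegral (fun z => F z * (nodeSin h z)⁻¹ *
        ∫ x in a..b, nodeSin h x * (z - x)⁻¹) D := by
  have integrable {y : ℝ} (hy : |y| = D) : IntervalIntegrable (fun x : ℝ => ∫ t : ℝ,
      F (t + y * I) * (nodeSin h (t + y * I))⁻¹ * (nodeSin h x * ((t : ℂ) + y * I - x)⁻¹))
      volume a b :=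
    intervalIntegrable_iff.2 (H.integrable_prod_nodeSin hh hy a b).integral_prod_left
  simp only [stripIntegral]
  rw [intervalIntegral.integral_sub (integrable H.abs_neg_eq) (integrable H.abs_eq),
    intervalIntegral_integral_swap (H.integrable_prod_nodeSin hh H.abs_neg_eq a b),
    intervalIntegral_integral_swap (H.integrable_prod_nodeSin hh H.abs_eq a b)]
  simp only [intervalIntegral.integral_const_mul]

theorem sinc_indefinite_error (H : StripDecay F D g) (hh : 0 < h)
    (hs : Summable fun k : ℤ => F (k * h : ℝ)) (a b : ℝ) :
    2 * Real.pi * I * ((∫ x in a..b, F (x : ℂ)) -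
        ∑' k : ℤ, F (k * h : ℝ) * (J k h b - J k h a : ℝ)) =
      stripIntegral (fun z => F z * (nodeSin h z)⁻¹ *
        ∫ x in a..b, nodeSin h x * (z - x)⁻¹) D := by
  have bound (k : ℤ) (x : ℝ) :
      ‖F (k * h : ℝ) * (Real.sinc (Real.pi * (x / h - k)) : ℝ)‖ ≤ ‖F (k * h : ℝ)‖ := by
    rw [norm_mul, norm_real]
    exact mul_le_of_le_one_right (norm_nonneg _) (Real.abs_sinc_le_one _)
  have continuous (k : ℤ) : Continuous fun x : ℝ =>
      F (k * h : ℝ) * (Real.sinc (Real.pi * (x / h - k)) : ℝ) :=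
    continuous_const.mul (Complex.continuous_ofReal.comp (continuous_sinc_node k h))
  have hsum := intervalIntegral.hasSum_integral_of_dominated_convergence (a := a) (b := b)
    (μ := volume) (fun (k : ℤ) (_ : ℝ) => ‖F (k * h : ℝ)‖)
    (fun k => (continuous k).aestronglyMeasurable) (fun k => .of_forall fun x _ => bound k x)
    (.of_forall fun x _ => hs.norm) intervalIntegrable_const
    (.of_forall fun x _ => (Summable.of_norm_bounded hs.norm fun k => bound k x).hasSum)
  simp only [intervalIntegral.integral_const_mul, intervalIntegral.integral_ofReal,
    integral_sinc_node _ hh.ne'] at hsum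
  rw [← H.intervalIntegral_stripIntegral hh, hsum.tsum_eq, ← intervalIntegral.integral_sub
    (H.continuous_ofReal.intervalIntegrable _ _)
    ((continuous_tsum continuous hs.norm bound).intervalIntegrable _ _),
    ← intervalIntegral.integral_const_mul]
  simp only [H.sinc_interpolation_error hh hs]

theorem norm_stripIntegral_indefinite_le (H : StripDecay F D g) (hh : 0 < h) {a b : ℝ}
    (hab : a ≤ b) (ha : Real.cos (Real.pi / h * a) = 0) :
    ‖stripIntegral (fun z => F z * (nodeSin h z)⁻¹ *
        ∫ x in a..b, nodeSin h x * (z - x)⁻¹) D‖ ≤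
      stripNorm F D *
        ((Real.sinh (Real.pi / h * D))⁻¹ * (h / Real.pi * ((1 + Real.pi) / D))) := by
  have line {y : ℝ} (hy : |y| = D) :
      ‖∫ t : ℝ, F (t + y * I) * (nodeSin h (t + y * I))⁻¹ *
        ∫ x in a..b, nodeSin h x * ((t : ℂ) + y * I - x)⁻¹‖ ≤ (∫ t : ℝ, ‖F (t + y * I)‖) *
        ((Real.sinh (Real.pi / h * D))⁻¹ * (h / Real.pi * ((1 + Real.pi) / D))) := by
    have hy₀ := H.ne_zero_of_abs_eq hy
    rw [← integral_mul_const]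
    refine norm_integral_le_of_norm_le ((H.integrable_line hy.le).norm.mul_const _)
      (.of_forall fun t => ?_)
    rw [norm_mul, norm_mul, mul_assoc, ← hy]
    gcongr
    exacts [norm_inv_nodeSin_le hh hy₀ t, norm_integral_nodeSin_mul_inv_sub_le hh hy₀ hab ha t]
  rw [stripNorm, add_mul]
  exact norm_sub_le_of_le (line H.abs_neg_eq) (line H.abs_eq)

theorem norm_intervalIntegral_sub_tsum_le (H : StripDecay F D g) (hh : 0 < h)
    (hs : Summable fun k : ℤ => F (k * h : ℝ)) {a b : ℝ} (hab : a ≤ b)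
    (ha : Real.cos (Real.pi / h * a) = 0) :
    ‖(∫ x in a..b, F (x : ℂ)) - ∑' k : ℤ, F (k * h : ℝ) * (J k h b - J k h a : ℝ)‖ ≤
      stripNorm F D * (h / (4 * D) * (Real.sinh (Real.pi / h * D))⁻¹) := by
  have hD := H.pos
  have hπ := Real.pi_pos
  have : 0 < Real.sinh (Real.pi / h * D) := Real.sinh_pos_iff.2 (by positivity)
  have hN := stripNorm_nonneg F D
  have error := H.norm_stripIntegral_indefinite_le hh hab ha
  rw [← H.sinc_indefinite_error hh hs, norm_mul, norm_mul, norm_mul, norm_I, norm_real, mul_one,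
    norm_ofNat, Real.norm_eq_abs, abs_of_pos hπ] at error
  have constant : (1 + Real.pi) / Real.pi ≤ Real.pi / 2 := by
    rw [div_le_div_iff₀ hπ two_pos]
    nlinarith [Real.pi_gt_d2]
  refine le_of_mul_le_mul_left (error.trans ?_) (by positivity : 0 < 2 * Real.pi)
  calc _ = stripNorm F D * (Real.sinh (Real.pi / h * D))⁻¹ * (h / D) *
        ((1 + Real.pi) / Real.pi) := by ring
    _ ≤ stripNorm F D * (Real.sinh (Real.pi / h * D))⁻¹ * (h / D) * (Real.pi / 2) := by gcongr
    _ = _ := by ring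

theorem discretization_error (H : StripDecay F D g) (hh : 0 < h)
    (hs : Summable fun k : ℤ => F (k * h : ℝ)) (b : ℝ) :
    ‖(∫ x in Iic b, F (x : ℂ)) - ∑' k : ℤ, F (k * h : ℝ) * (J k h b : ℝ)‖ ≤
      stripNorm F D * (h / (4 * D) * (Real.sinh (Real.pi / h * D))⁻¹) := by
  have endpoints : Tendsto (fun m : ℕ => -((m : ℝ) * h + h / 2)) atTop atBot :=
    tendsto_neg_atTop_atBot.comp
      (tendsto_atTop_add_const_right _ _ (tendsto_natCast_atTop_atTop.atTop_mul_const hh))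
  refine le_of_tendsto ((intervalIntegral_tendsto_integral_Iic b
    H.integrable_ofReal.integrableOn endpoints).sub (tendsto_tsum_mul_J hs hh b endpoints)).norm ?_
  filter_upwards [endpoints.eventually (eventually_le_atBot b)] with m hm
  exact H.norm_intervalIntegral_sub_tsum_le hh hs hm
    (by rw [mul_neg, Real.cos_neg, cos_half_node hh.ne'])

end StripDecay

section StripGeometry

theorem sq_le_sinh_sq (x : ℝ) : x ^ 2 ≤ Real.sinh x ^ 2 := by
  rw [sq_le_sq, Real.abs_sinh]
  exact Real.self_le_sinh_iff.2 (abs_nonneg _)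

theorem one_add_sq_div_two_le_cosh (x : ℝ) : 1 + x ^ 2 / 2 ≤ Real.cosh x := by
  have half_angle : Real.cosh x = 1 + 2 * Real.sinh (x / 2) ^ 2 := by
    have double := Real.cosh_two_mul (x / 2)
    rw [mul_div_cancel₀ x two_ne_zero, Real.cosh_sq] at double
    linarith
  linarith [sq_le_sinh_sq (x / 2)]

theorem one_add_sq_mul_cosh_sub_one_le (A t : ℝ) :
    1 + A ^ 2 * (Real.cosh t - 1) ≤ Real.cosh (A * Real.sinh t) := by
  refine le_trans ?_ (one_add_sq_div_two_le_cosh _)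
  have : Real.cosh t - 1 ≤ Real.sinh t ^ 2 / 2 := by
    nlinarith [Real.cosh_sq t, sq_nonneg (Real.cosh t - 1)]
  calc _ ≤ 1 + A ^ 2 * (Real.sinh t ^ 2 / 2) := by gcongr
    _ = _ := by ring

theorem one_le_sin_add_mul_cos {B : ℝ} (hB : 0 ≤ B) (hB' : B ≤ Real.pi / 2) :
    1 ≤ Real.sin B + (Real.pi - B) * Real.cos B := by
  obtain ⟨e, rfl⟩ : ∃ e, B = Real.pi / 2 - e := ⟨Real.pi / 2 - B, by ring⟩
  rw [Real.sin_pi_div_two_sub, Real.cos_pi_div_two_sub]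
  have jordan : 2 / Real.pi * e ≤ Real.sin e := Real.mul_le_sin (by linarith) (by linarith)
  have hsin : Real.pi / 2 * (2 / Real.pi * e) ≤ (Real.pi - (Real.pi / 2 - e)) * Real.sin e :=
    mul_le_mul (by linarith) jordan (mul_nonneg (by positivity) (by linarith)) (by linarith)
  have cancel : Real.pi / 2 * (2 / Real.pi * e) = e := by field_simp
  nlinarith [Real.one_sub_sq_div_two_le_cos (x := e), Real.pi_le_four]

theorem abs_sin_le_tangent {B x : ℝ} (hB : 0 ≤ B) (hB' : B ≤ Real.pi / 2) (hx : B ≤ x) :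
    |Real.sin x| ≤ Real.sin B + (x - B) * Real.cos B := by
  rcases hx.eq_or_lt with rfl | hlt
  · rw [sub_self, zero_mul, add_zero,
      abs_of_nonneg (Real.sin_nonneg_of_nonneg_of_le_pi hB (by linarith))]
  rcases le_total x Real.pi with h | h
  · rw [abs_of_nonneg (Real.sin_nonneg_of_nonneg_of_le_pi (hB.trans hx) h)]
    have slope := strictConcaveOn_sin_Icc.concaveOn.slope_le_of_hasDerivAt
      ⟨hB, hx.trans h⟩ ⟨hB.trans hx, h⟩ hlt (Real.hasDerivAt_sin B)
    rw [slope_def_field, div_le_iff₀ (sub_pos.2 hlt)] at slope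
    linarith
  · have : 0 ≤ Real.cos B := Real.cos_nonneg_of_mem_Icc ⟨by linarith, hB'⟩
    calc |Real.sin x| ≤ 1 := Real.abs_sin_le_one x
      _ ≤ Real.sin B + (Real.pi - B) * Real.cos B := one_le_sin_add_mul_cos hB hB'
      _ ≤ _ := by gcongr

theorem mul_cos_le_mul_sin {B : ℝ} (hB : 0 ≤ B) (hB' : B ≤ Real.pi / 2) :
    B * Real.cos B ≤ ((Real.pi / 2) ^ 2 - B ^ 2) * Real.sin B := by
  have hcos : Real.cos B ≤ Real.pi / 2 - B := by
    rw [← Real.sin_pi_div_two_sub]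
    exact Real.sin_le (by linarith)
  calc B * Real.cos B ≤ B * (Real.pi / 2 - B) := by gcongr
    _ = (Real.pi / 2 - B) * (Real.pi / 2) * (2 / Real.pi * B) := by field_simp
    _ ≤ (Real.pi / 2 - B) * (Real.pi / 2 + B) * Real.sin B := by
        refine mul_le_mul (mul_le_mul_of_nonneg_left (by linarith) (by linarith))
          (Real.mul_le_sin hB hB') (by positivity) (mul_nonneg (by linarith) (by linarith))
    _ = _ := by ring

/-- The smallest value of `|1 + exp (π sinh ζ)| / (1 + exp (Re (π sinh ζ)))` over `|Im ζ| ≤ D`,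
attained at `Re ζ = 0`; it is the quantity `cos (π/2 sin d)` of the error constant. -/
noncomputable def kappa (D : ℝ) : ℝ := Real.cos (Real.pi / 2 * Real.sin D)

variable {D : ℝ}

theorem pi_div_two_mul_sin_mem_Icc (hD : 0 ≤ D) (hD' : D ≤ Real.pi / 2) :
    Real.pi / 2 * Real.sin D ∈ Icc 0 (Real.pi / 2) :=
  ⟨mul_nonneg (by positivity) (Real.sin_nonneg_of_nonneg_of_le_pi hD (by linarith)),
    mul_le_of_le_one_right (by positivity) (Real.sin_le_one D)⟩

theorem kappa_pos (hD : 0 ≤ D) (hD' : D < Real.pi / 2) : 0 < kappa D := by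
  have : Real.sin D < 1 := by
    rw [← Real.sin_pi_div_two]
    exact Real.sin_lt_sin_of_lt_of_le_pi_div_two (by linarith) le_rfl hD'
  have := (pi_div_two_mul_sin_mem_Icc hD hD'.le).1
  exact Real.cos_pos_of_mem_Ioo ⟨by linarith, by nlinarith⟩

theorem kappa_anti {y : ℝ} (hy : 0 ≤ y) (hyD : y ≤ D) (hD : D ≤ Real.pi / 2) :
    kappa D ≤ kappa y := by
  have hsin := Real.sin_le_sin_of_le_of_le_pi_div_two (by linarith) hD hyD
  refine Real.cos_le_cos_of_nonneg_of_le_pi (pi_div_two_mul_sin_mem_Icc hy (hyD.trans hD)).1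
    ?_ (by gcongr)
  linarith [(pi_div_two_mul_sin_mem_Icc (hy.trans hyD) hD).2]

theorem abs_sin_cosh_mul_le {y : ℝ} (hy : 0 ≤ y) (hy' : y ≤ Real.pi / 2) (t : ℝ) :
    |Real.sin (Real.cosh t * (Real.pi / 2 * Real.sin y))| ≤
      Real.sin (Real.pi / 2 * Real.sin y) *
        Real.cosh (Real.pi / 2 * Real.cos y * Real.sinh t) := by
  obtain ⟨hB, hB'⟩ := pi_div_two_mul_sin_mem_Icc hy hy'
  set B := Real.pi / 2 * Real.sin y with hBdef
  set A := Real.pi / 2 * Real.cos y with hAdef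
  have pythagoras : A ^ 2 = (Real.pi / 2) ^ 2 - B ^ 2 := by
    rw [hAdef, hBdef]
    linear_combination (Real.pi / 2) ^ 2 * Real.sin_sq_add_cos_sq y
  have hsinB : 0 ≤ Real.sin B := Real.sin_nonneg_of_nonneg_of_le_pi hB (by linarith)
  have hcosh : 0 ≤ Real.cosh t - 1 := sub_nonneg.2 (Real.one_le_cosh t)
  calc |Real.sin (Real.cosh t * B)|
      ≤ Real.sin B + (Real.cosh t * B - B) * Real.cos B :=
        abs_sin_le_tangent hB hB' (le_mul_of_one_le_left hB (Real.one_le_cosh t))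
    _ = Real.sin B + (Real.cosh t - 1) * (B * Real.cos B) := by ring
    _ ≤ Real.sin B + (Real.cosh t - 1) * (A ^ 2 * Real.sin B) := by
        rw [pythagoras]
        gcongr Real.sin B + (Real.cosh t - 1) * ?_
        exact mul_cos_le_mul_sin hB hB'
    _ = Real.sin B * (1 + A ^ 2 * (Real.cosh t - 1)) := by ring
    _ ≤ _ := mul_le_mul_of_nonneg_left (one_add_sq_mul_cosh_sub_one_le A t) hsinB

theorem norm_cosh_sq (z : ℂ) : ‖cosh z‖ ^ 2 = Real.cosh z.re ^ 2 - Real.sin z.im ^ 2 := by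
  have parts : cosh z = (Real.cosh z.re * Real.cos z.im : ℝ) +
      (Real.sinh z.re * Real.sin z.im : ℝ) * I := by
    conv_lhs => rw [← re_add_im z, cosh_add, sinh_mul_I, cosh_mul_I]
    push_cast
    ring
  rw [parts, ← normSq_eq_norm_sq, normSq_add_mul_I]
  linear_combination Real.cosh z.re ^ 2 * Real.sin_sq_add_cos_sq z.im -
    Real.sin z.im ^ 2 * Real.cosh_sq z.re

theorem norm_cosh_le (z : ℂ) : ‖cosh z‖ ≤ Real.cosh z.re :=
  le_of_sq_le_sq (by linarith [norm_cosh_sq z, sq_nonneg (Real.sin z.im)]) (Real.cosh_pos _).le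

theorem one_add_exp_eq (w : ℂ) : 1 + exp w = 2 * exp (w / 2) * cosh (w / 2) := by
  rw [cosh, mul_assoc, mul_div_assoc', mul_div_cancel₀ _ two_ne_zero, mul_add,
    ← exp_add, ← exp_add, add_halves, add_neg_cancel, exp_zero, add_comm]

theorem one_add_exp_mul_cos_le_norm {w : ℂ} {B : ℝ}
    (h : |Real.sin (w.im / 2)| ≤ Real.sin B * Real.cosh (w.re / 2)) :
    (1 + Real.exp w.re) * Real.cos B ≤ ‖1 + exp w‖ := by
  have real : 1 + Real.exp w.re = 2 * Real.exp (w.re / 2) * Real.cosh (w.re / 2) := by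
    exact_mod_cast one_add_exp_eq w.re
  have : Real.cosh (w.re / 2) * Real.cos B ≤ ‖cosh (w / 2)‖ := by
    refine le_of_sq_le_sq ?_ (norm_nonneg _)
    rw [norm_cosh_sq, div_ofNat_re, div_ofNat_im, mul_pow, Real.cos_sq']
    nlinarith [pow_le_pow_left₀ (abs_nonneg _) h 2, sq_abs (Real.sin (w.im / 2))]
  rw [one_add_exp_eq, norm_mul, norm_mul, norm_exp, div_ofNat_re, norm_ofNat, real, mul_assoc]
  gcongr

theorem sinh_eq_re_add_im_mul_I (z : ℂ) :
    sinh z = (Real.sinh z.re * Real.cos z.im : ℝ) + (Real.cosh z.re * Real.sin z.im : ℝ) * I := by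
  conv_lhs => rw [← re_add_im z, sinh_add, sinh_mul_I, cosh_mul_I]
  push_cast
  ring

theorem pi_mul_sinh_re (z : ℂ) :
    (Real.pi * sinh z).re = Real.pi * (Real.sinh z.re * Real.cos z.im) := by
  rw [sinh_eq_re_add_im_mul_I, re_ofReal_mul, add_re, ofReal_re, re_ofReal_mul, I_re, mul_zero,
    add_zero]

theorem pi_mul_sinh_im (z : ℂ) :
    (Real.pi * sinh z).im = Real.pi * (Real.cosh z.re * Real.sin z.im) := by
  rw [sinh_eq_re_add_im_mul_I, im_ofReal_mul, add_im, ofReal_im, im_ofReal_mul, I_im, mul_one,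
    zero_add]

theorem one_add_exp_mul_kappa_le_norm {ζ : ℂ} (hζ : |ζ.im| ≤ D) (hD : D < Real.pi / 2) :
    (1 + Real.exp (Real.pi * sinh ζ).re) * kappa D ≤ ‖1 + exp (Real.pi * sinh ζ)‖ := by
  have key := abs_sin_cosh_mul_le (abs_nonneg ζ.im) (hζ.trans hD.le) ζ.re
  have him : |Real.sin (Real.cosh ζ.re * (Real.pi / 2 * Real.sin |ζ.im|))| =
      |Real.sin ((Real.pi * sinh ζ).im / 2)| := by
    rw [pi_mul_sinh_im]
    rcases abs_choice ζ.im with h | h <;> rw [h]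
    · congr 2
      ring
    · rw [Real.sin_neg, ← abs_neg, ← Real.sin_neg]
      congr 2
      ring
  have hre : Real.pi / 2 * Real.cos |ζ.im| * Real.sinh ζ.re = (Real.pi * sinh ζ).re / 2 := by
    rw [pi_mul_sinh_re, Real.cos_abs]
    ring
  rw [him, hre] at key
  refine le_trans ?_ (one_add_exp_mul_cos_le_norm key)
  gcongr
  exact kappa_anti (abs_nonneg _) hζ hD.le

theorem one_add_exp_neg_mul_kappa_le_norm {ζ : ℂ} (hζ : |ζ.im| ≤ D) (hD : D < Real.pi / 2) :
    (1 + Real.exp (-(Real.pi * sinh ζ).re)) * kappa D ≤ ‖1 + exp (-(Real.pi * sinh ζ))‖ := by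
  simpa only [sinh_neg, mul_neg, neg_re] using
    one_add_exp_mul_kappa_le_norm (ζ := -ζ) (by rwa [neg_im, abs_neg]) hD

end StripGeometry

section Weight

theorem norm_one_sub_exp_neg_le (z : ℂ) : ‖1 - exp (-z)‖ ≤ Real.exp ‖z‖ - 1 := by
  simpa [norm_sub_rev] using norm_exp_sub_sum_le_exp_norm_sub_sum (-z) 1

theorem exp_sub_one_le_of_le_log {r c : ℝ} (hc : 0 < c) (hr : 0 ≤ r) (hrc : r ≤ Real.log (1 + c)) :
    Real.exp r - 1 ≤ r / Real.log (1 + c) * c := by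
  have hlog : 0 < Real.log (1 + c) := Real.log_pos (by linarith)
  have chord := convexOn_exp.2 (mem_univ 0) (mem_univ (Real.log (1 + c)))
    (sub_nonneg.2 ((div_le_one hlog).2 hrc)) (div_nonneg hr hlog.le) (sub_add_cancel _ _)
  rw [smul_zero, zero_add, smul_eq_mul, smul_eq_mul, smul_eq_mul, div_mul_cancel₀ _ hlog.ne',
    Real.exp_zero, Real.exp_log (by linarith)] at chord
  linarith

theorem norm_one_add_div_mul_le {z : ℂ} {c : ℝ} (hz : z ≠ 0) (hc : 0 < c)
    (hzc : ‖1 - exp (-z)‖ ≤ c) :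
    ‖(1 + z) / z * (1 - exp (-z))‖ ≤ (1 + Real.log (1 + c)) / Real.log (1 + c) * c := by
  have hR : 0 < Real.log (1 + c) := Real.log_pos (by linarith)
  have hz₀ : 0 < ‖z‖ := norm_pos_iff.2 hz
  have triangle : ‖1 + z‖ ≤ 1 + ‖z‖ := by simpa using norm_add_le 1 z
  rw [norm_mul, norm_div]
  rcases le_total ‖z‖ (Real.log (1 + c)) with h | h
  · calc ‖1 + z‖ / ‖z‖ * ‖1 - exp (-z)‖
        ≤ (1 + Real.log (1 + c)) / ‖z‖ * (‖z‖ / Real.log (1 + c) * c) := by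
          gcongr
          · linarith
          · exact (norm_one_sub_exp_neg_le z).trans (exp_sub_one_le_of_le_log hc hz₀.le h)
      _ = _ := by field_simp
  · refine mul_le_mul ?_ hzc (norm_nonneg _) (by positivity)
    rw [div_le_div_iff₀ hz₀ hR]
    nlinarith

theorem one_add_mul_one_sub_exp_neg_le {x : ℝ} (hx : 0 ≤ x) :
    (1 + x) * (1 - Real.exp (-x)) ≤ 13 / 8 * x := by
  rcases le_total (8 / 5) x with h | h
  · nlinarith [Real.exp_pos (-x)]
  · have product : (1 - 5 / 8 * x) * (1 - 3 / 8 * x) ≤ Real.exp (-x) := by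
      calc _ ≤ Real.exp (-(5 / 8 * x)) * Real.exp (-(3 / 8 * x)) :=
            mul_le_mul (Real.one_sub_le_exp_neg _) (Real.one_sub_le_exp_neg _) (by linarith)
              (Real.exp_pos _).le
        _ = _ := by rw [← Real.exp_add]; ring_nf
    nlinarith [mul_le_mul_of_nonneg_left product (by linarith : 0 ≤ 1 + x),
      mul_nonneg (mul_nonneg hx (by linarith : 0 ≤ 5 - 3 * x)) (by linarith : 0 ≤ 1 - 5 / 8 * x)]

theorem norm_E3 (α β : ℝ) (z : ℂ) :
    ‖E3 α β z‖ = ‖(1 + z) / z‖ ^ (1 - α) * ‖exp z‖ ^ (-β) := by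
  have exponent : (α : ℂ) - 1 = (-(1 - α) : ℝ) := by push_cast; ring
  rw [E3, norm_mul, exponent, norm_cpow_real, Real.rpow_neg (norm_nonneg _),
    ← Real.inv_rpow (norm_nonneg _), ← norm_inv, inv_div, norm_exp, norm_exp, ← Real.exp_mul,
    ← ofReal_neg, re_ofReal_mul, mul_comm (-β)]

/-- The size of the transformed integrand, up to the factor `cosh`, at a point where
`Re (π sinh ζ) = a`: it decays like `exp (α a)` at `-∞` and like `exp (-β a)` at `+∞`. -/
noncomputable def deWeight (α β a : ℝ) : ℝ := (1 + Real.exp a) ^ (-β) * (1 + Real.exp (-a)) ^ (-α)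

variable {α β a : ℝ}

theorem deWeight_neg : deWeight α β (-a) = deWeight β α a := by
  rw [deWeight, deWeight, neg_neg, mul_comm]

theorem deWeight_le_exp (hα : 0 ≤ α) (hβ : 0 ≤ β) : deWeight α β a ≤ Real.exp (α * a) := by
  have hright : (1 + Real.exp a) ^ (-β) ≤ 1 :=
    Real.rpow_le_one_of_one_le_of_nonpos (by linarith [Real.exp_pos a]) (neg_nonpos.2 hβ)
  have hleft : (1 + Real.exp (-a)) ^ (-α) ≤ Real.exp (-a) ^ (-α) :=
    Real.rpow_le_rpow_of_nonpos (Real.exp_pos _) (by linarith) (neg_nonpos.2 hα)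
  calc deWeight α β a ≤ 1 * Real.exp (-a) ^ (-α) := by unfold deWeight; gcongr
    _ = _ := by rw [one_mul, ← Real.exp_mul, neg_mul_neg, mul_comm]

theorem deWeight_le_exp_neg (hα : 0 ≤ α) (hβ : 0 ≤ β) : deWeight α β a ≤ Real.exp (-(β * a)) := by
  rw [← neg_neg a, deWeight_neg, neg_neg, ← mul_neg]
  exact deWeight_le_exp hβ hα

theorem deWeight_le_exp_abs (hα : 0 ≤ α) (hβ : 0 ≤ β) :
    deWeight α β a ≤ Real.exp (-(min α β * |a|)) := by
  rcases le_total 0 a with ha | ha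
  · refine (deWeight_le_exp_neg hα hβ).trans ?_
    rw [abs_of_nonneg ha]
    gcongr
    exact min_le_right _ _
  · refine (deWeight_le_exp hα hβ).trans ?_
    rw [abs_of_nonpos ha, mul_neg, neg_neg, Real.exp_le_exp]
    exact mul_le_mul_of_nonpos_right (min_le_left _ _) ha

theorem norm_E3_mul_inv_le {κ C : ℝ} {z P : ℂ} (hα : 0 ≤ α) (hα₁ : α ≤ 1) (hβ : 0 ≤ β)
    (hκ : 0 < κ) (hz : (1 + Real.exp a) * κ ≤ ‖exp z‖) (hP : (1 + Real.exp (-a)) * κ ≤ ‖P‖)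
    (hC : ‖(1 + z) / z * P⁻¹‖ ≤ C) :
    ‖E3 α β z‖ * ‖P⁻¹‖ ≤ C ^ (1 - α) / κ ^ (α + β) * deWeight α β a := by
  have hP₀ : 0 < ‖P‖ := lt_of_lt_of_le (by positivity) hP
  have hC₀ : 0 ≤ C := (norm_nonneg _).trans hC
  have split : ‖P⁻¹‖ = ‖P⁻¹‖ ^ (1 - α) * ‖P‖ ^ (-α) := by
    rw [norm_inv, Real.inv_rpow hP₀.le, ← Real.rpow_neg hP₀.le, ← Real.rpow_add hP₀,
      show -(1 - α) + -α = -1 by ring, Real.rpow_neg_one]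
  have rational : ‖(1 + z) / z‖ ^ (1 - α) * ‖P⁻¹‖ ^ (1 - α) ≤ C ^ (1 - α) := by
    rw [← Real.mul_rpow (norm_nonneg _) (norm_nonneg _), ← norm_mul]
    exact Real.rpow_le_rpow (norm_nonneg _) hC (sub_nonneg.2 hα₁)
  have power {b γ x : ℝ} (hγ : 0 ≤ γ) (hx : (1 + Real.exp b) * κ ≤ x) :
      x ^ (-γ) ≤ (1 + Real.exp b) ^ (-γ) * κ ^ (-γ) := by
    rw [← Real.mul_rpow (by positivity) hκ.le]
    exact Real.rpow_le_rpow_of_nonpos (by positivity) hx (neg_nonpos.2 hγ)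
  calc ‖E3 α β z‖ * ‖P⁻¹‖
      = ‖(1 + z) / z‖ ^ (1 - α) * ‖P⁻¹‖ ^ (1 - α) * (‖exp z‖ ^ (-β) * ‖P‖ ^ (-α)) := by
        rw [mul_mul_mul_comm, ← split, ← norm_E3]
    _ ≤ C ^ (1 - α) * ((1 + Real.exp a) ^ (-β) * κ ^ (-β) *
          ((1 + Real.exp (-a)) ^ (-α) * κ ^ (-α))) := by
        gcongr
        exacts [power hβ hz, power hα hP]
    _ = C ^ (1 - α) * κ ^ (-(α + β)) * deWeight α β a := by
        rw [neg_add, Real.rpow_add hκ, deWeight]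
        ring
    _ = _ := by rw [Real.rpow_neg hκ.le, ← div_eq_mul_inv]

end Weight

section Majorant

variable {k : ℝ}

theorem cosh_mul_exp_le (hk : 0 < k) (t : ℝ) :
    Real.cosh t * Real.exp (-(k * |Real.sinh t|)) ≤ 6 * Real.exp k / k ^ 3 * (1 + t ^ 2)⁻¹ := by
  have hts : t ^ 2 ≤ |Real.sinh t| ^ 2 := (sq_le_sinh_sq t).trans_eq (sq_abs _).symm
  set s := |Real.sinh t| with hs
  have hs₀ : 0 ≤ s := abs_nonneg _
  have hcosh : Real.cosh t ≤ 1 + s := by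
    refine le_of_sq_le_sq ?_ (by positivity)
    rw [Real.cosh_sq, ← sq_abs (Real.sinh t), ← hs]
    nlinarith
  have cubic : (k * (1 + s)) ^ 3 / 6 ≤ Real.exp (k * (1 + s)) := by
    simpa [Nat.factorial] using Real.pow_div_factorial_le_exp (x := k * (1 + s)) (by positivity) 3
  have shift : Real.exp (-(k * s)) = Real.exp k * (Real.exp (k * (1 + s)))⁻¹ := by
    rw [← Real.exp_neg, ← Real.exp_add]
    ring_nf
  calc Real.cosh t * Real.exp (-(k * s))
      ≤ (1 + s) * (Real.exp k * ((k * (1 + s)) ^ 3 / 6)⁻¹) := by rw [shift]; gcongr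
    _ = 6 * Real.exp k / k ^ 3 * ((1 + s) ^ 2)⁻¹ := by field_simp
    _ ≤ _ := by
        gcongr
        nlinarith

theorem tendsto_exp_neg_mul_sinh (hk : 0 < k) :
    Tendsto (fun t => Real.exp (-(k * Real.sinh t))) atTop (𝓝 0) := by
  have hsinh : Tendsto Real.sinh atTop atTop := by
    refine tendsto_atTop_mono' _ ?_ tendsto_id
    filter_upwards [eventually_ge_atTop 0] with t ht using Real.self_le_sinh_iff.2 ht
  exact Real.tendsto_exp_neg_atTop_nhds_zero.comp (hsinh.const_mul_atTop hk)

theorem hasDerivAt_exp_neg_mul_sinh (hk : k ≠ 0) (t : ℝ) :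
    HasDerivAt (fun t => -(k⁻¹ * Real.exp (-(k * Real.sinh t))))
      (Real.cosh t * Real.exp (-(k * Real.sinh t))) t := by
  refine (((Real.hasDerivAt_sinh t).const_mul k).neg.exp.const_mul k⁻¹).neg.congr_deriv ?_
  simp only [Pi.neg_apply]
  field_simp

theorem integral_cosh_mul_exp (hk : 0 < k) :
    ∫ t in Ioi (0 : ℝ), Real.cosh t * Real.exp (-(k * Real.sinh t)) = k⁻¹ := by
  have hlim : Tendsto (fun t => -(k⁻¹ * Real.exp (-(k * Real.sinh t)))) atTop (𝓝 0) := by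
    simpa using ((tendsto_exp_neg_mul_sinh hk).const_mul k⁻¹).neg
  rw [integral_Ioi_of_hasDerivAt_of_nonneg' (fun t _ => hasDerivAt_exp_neg_mul_sinh hk.ne' t)
    (fun t _ => by positivity) hlim]
  simp

theorem integral_cosh_mul_exp_abs (hk : 0 < k) :
    ∫ t : ℝ, Real.cosh t * Real.exp (-(k * |Real.sinh t|)) = 2 * k⁻¹ := by
  have even := integral_comp_abs (f := fun t => Real.cosh t * Real.exp (-(k * Real.sinh t)))
  simp only [Real.cosh_abs, ← Real.abs_sinh] at even
  rw [even, integral_cosh_mul_exp hk]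

theorem integrable_cosh_mul_exp_abs (hk : 0 < k) :
    Integrable fun t : ℝ => Real.cosh t * Real.exp (-(k * |Real.sinh t|)) := by
  have hcont : Continuous fun t : ℝ => Real.cosh t * Real.exp (-(k * |Real.sinh t|)) := by
    have := Real.continuous_cosh
    have := Real.continuous_sinh
    fun_prop
  refine (integrable_inv_one_add_sq.const_mul (6 * Real.exp k / k ^ 3)).mono'
    hcont.aestronglyMeasurable (Eventually.of_forall fun t => ?_)
  rw [Real.norm_eq_abs, abs_of_pos (by positivity)]
  exact cosh_mul_exp_le hk t

theorem tendsto_inv_one_add_sq_cocompact :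
    Tendsto (fun t : ℝ => (1 + t ^ 2)⁻¹) (cocompact ℝ) (𝓝 0) := by
  have hsq := (tendsto_pow_atTop two_ne_zero).comp (tendsto_norm_cocompact_atTop (E := ℝ))
  simpa [Function.comp_def] using tendsto_inv_atTop_zero.comp (tendsto_atTop_add_const_left _ 1 hsq)

theorem summable_inv_one_add_sq_nodes {h : ℝ} (hh : h ≠ 0) :
    Summable fun k : ℤ => (1 + ((k : ℝ) * h) ^ 2)⁻¹ := by
  have hs : Summable fun k : ℤ => (h ^ 2)⁻¹ * (1 / (k : ℝ) ^ 2) :=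
    (Real.summable_one_div_int_pow.2 one_lt_two).mul_left _
  refine hs.of_norm_bounded_eventually ((finite_singleton 0).subset fun k hk => ?_)
  by_contra hk₀
  have : (k : ℝ) ≠ 0 := Int.cast_ne_zero.2 hk₀
  refine hk (?_ : ‖(1 + ((k : ℝ) * h) ^ 2)⁻¹‖ ≤ (h ^ 2)⁻¹ * (1 / (k : ℝ) ^ 2))
  rw [Real.norm_eq_abs, abs_of_pos (by positivity), one_div, ← mul_inv]
  exact inv_anti₀ (by positivity) (by linarith [mul_pow (k : ℝ) h 2])

end Majorant

section Transform

variable {d : ℝ} {ζ : ℂ}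

theorem strip_mono {d' : ℝ} (h : d ≤ d') : strip d ⊆ strip d' := fun _ hz => lt_of_lt_of_le hz h

theorem isOpen_strip (d : ℝ) : IsOpen (strip d) :=
  isOpen_lt continuous_im.abs continuous_const

theorem one_sub_exp_neg_psi_mul (h : ζ ∈ strip (Real.pi / 2)) :
    (1 - exp (-psi ζ)) * (1 + exp (-(Real.pi * sinh ζ))) = 1 := by
  have psi_inv : exp (-psi ζ) * (1 + exp (Real.pi * sinh ζ)) = 1 := by
    rw [← exp_psi h, ← exp_add, neg_add_cancel, exp_zero]
  have sinh_inv : exp (Real.pi * sinh ζ) * exp (-(Real.pi * sinh ζ)) = 1 := by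
    rw [← exp_add, add_neg_cancel, exp_zero]
  linear_combination -exp (-(Real.pi * sinh ζ)) * psi_inv + exp (-psi ζ) * sinh_inv

theorem one_add_exp_neg_ne_zero (h : ζ ∈ strip (Real.pi / 2)) :
    1 + exp (-(Real.pi * sinh ζ)) ≠ 0 := fun h₀ => by
  simpa [h₀] using one_sub_exp_neg_psi_mul h

theorem one_sub_exp_neg_psi (h : ζ ∈ strip (Real.pi / 2)) :
    1 - exp (-psi ζ) = (1 + exp (-(Real.pi * sinh ζ)))⁻¹ :=
  eq_inv_of_mul_eq_one_left (one_sub_exp_neg_psi_mul h)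

theorem psi_ne_zero (h : ζ ∈ strip (Real.pi / 2)) : psi ζ ≠ 0 := fun h₀ => by
  simpa [h₀] using one_sub_exp_neg_psi_mul h

/-- The integrand `f (ψ ζ) ψ' ζ` produced by the double-exponential change of variables. -/
noncomputable def deF (f : ℂ → ℂ) (ζ : ℂ) : ℂ :=
  f (psi ζ) * (Real.pi * cosh ζ * (1 + exp (-(Real.pi * sinh ζ)))⁻¹)

theorem cD_pos (hd : 0 ≤ d) (hd' : d < Real.pi / 2) : 0 < cD d := by
  have : 0 < 1 / kappa d := one_div_pos.2 (kappa_pos hd hd')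
  exact add_pos one_pos this

theorem log_one_add_cD_pos (hd : 0 ≤ d) (hd' : d < Real.pi / 2) : 0 < Real.log (1 + cD d) :=
  Real.log_pos (by linarith [cD_pos hd hd'])

theorem cTilde_pos (hd : 0 ≤ d) (hd' : d < Real.pi / 2) : 0 < cTilde d := by
  have := cD_pos hd hd'
  have := log_one_add_cD_pos hd hd'
  unfold cTilde
  positivity

theorem norm_one_add_psi_div_mul_le_cTilde (hζ : |ζ.im| ≤ d) (hd : d < Real.pi / 2) :
    ‖(1 + psi ζ) / psi ζ * (1 - exp (-psi ζ))‖ ≤ cTilde d := by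
  have hmem : ζ ∈ strip (Real.pi / 2) := hζ.trans_lt hd
  have hd₀ : 0 ≤ d := (abs_nonneg _).trans hζ
  refine norm_one_add_div_mul_le (psi_ne_zero hmem) (cD_pos hd₀ hd) ?_
  have hκ : kappa d ≤ ‖1 + exp (-(Real.pi * sinh ζ))‖ :=
    (le_mul_of_one_le_left (kappa_pos hd₀ hd).le
      (by linarith [Real.exp_pos (-(Real.pi * sinh ζ).re)])).trans
      (one_add_exp_neg_mul_kappa_le_norm hζ hd)
  rw [one_sub_exp_neg_psi hmem, norm_inv]
  calc _ ≤ (kappa d)⁻¹ := inv_anti₀ (kappa_pos hd₀ hd) hκ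
    _ ≤ cD d := by rw [cD, one_div]; exact le_add_of_nonneg_left zero_le_one

theorem norm_one_add_psi_div_mul_ofReal_le (t : ℝ) :
    ‖(1 + psi t) / psi t * (1 - exp (-psi t))‖ ≤ 13 / 8 := by
  have hpos := psiReal_pos t
  have real : (1 + psi t) / psi t * (1 - exp (-psi t)) =
      ((1 + psiReal t) * (1 - Real.exp (-psiReal t)) / psiReal t : ℝ) := by
    rw [psi_ofReal]
    push_cast
    ring
  rw [real, norm_real, Real.norm_of_nonneg, div_le_iff₀ hpos]
  · exact one_add_mul_one_sub_exp_neg_le hpos.le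
  · have : 0 ≤ 1 - Real.exp (-psiReal t) := sub_nonneg.2 (Real.exp_le_one_iff.2 (by linarith))
    positivity

/-- The factor of the `L¹` bound of `deF f` on the lines `Im ζ = ± D`; at `D = d` it is, together
with `1 - exp (-π μ e)`, the first summand of the error constant. -/
noncomputable def lineFactor (α β D : ℝ) : ℝ :=
  cTilde D ^ (1 - α) / (kappa D ^ (α + β) * Real.cos D)

theorem cos_pos_of_lt_pi_div_two (hd : 0 ≤ d) (hd' : d < Real.pi / 2) : 0 < Real.cos d :=
  Real.cos_pos_of_mem_Ioo ⟨by linarith [Real.pi_pos], hd'⟩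

theorem lineFactor_pos (α β : ℝ) (hd : 0 ≤ d) (hd' : d < Real.pi / 2) : 0 < lineFactor α β d := by
  have := cTilde_pos hd hd'
  have := kappa_pos hd hd'
  have := cos_pos_of_lt_pi_div_two hd hd'
  unfold lineFactor
  positivity

theorem continuousAt_cTilde (hd : 0 ≤ d) (hd' : d < Real.pi / 2) : ContinuousAt cTilde d := by
  have hcos : Real.cos (Real.pi / 2 * Real.sin d) ≠ 0 := (kappa_pos hd hd').ne'
  have hcD : ContinuousAt cD d :=
    continuousAt_const.add (continuousAt_const.div (by fun_prop) hcos)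
  have hlog : ContinuousAt (fun D => Real.log (1 + cD D)) d :=
    (continuousAt_const.add hcD).log (add_pos one_pos (cD_pos hd hd')).ne'
  exact ((continuousAt_const.add hlog).div hlog (log_one_add_cD_pos hd hd').ne').mul hcD

theorem continuousAt_lineFactor (α β : ℝ) (hd : 0 ≤ d) (hd' : d < Real.pi / 2) :
    ContinuousAt (lineFactor α β) d := by
  have hκ := kappa_pos hd hd'
  have hcos := cos_pos_of_lt_pi_div_two hd hd'
  have hkappa : ContinuousAt kappa d := by
    unfold kappa
    fun_prop
  exact ((continuousAt_cTilde hd hd').rpow_const (Or.inl (cTilde_pos hd hd').ne')).div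
    ((hkappa.rpow_const (Or.inl hκ.ne')).mul Real.continuous_cos.continuousAt) (by positivity)

end Transform

/-- The hypotheses on the integrand: `f` is holomorphic on the image of the strip `|Im ζ| < d` and
is bounded there by a multiple of the comparison function `E3`. -/
structure DEIntegrand (f : ℂ → ℂ) (d K α β : ℝ) : Prop where
  pos : 0 < d
  lt : d < Real.pi / 2
  alpha_pos : 0 < α
  alpha_le_one : α ≤ 1
  beta_pos : 0 < β
  differentiableOn : DifferentiableOn ℂ f (psi '' strip d)
  norm_le : ∀ z ∈ psi '' strip d, ‖f z‖ ≤ K * ‖E3 α β z‖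

namespace DEIntegrand

variable {f : ℂ → ℂ} {d K α β D : ℝ} {ζ : ℂ}

theorem mu_pos (H : DEIntegrand f d K α β) : 0 < min α β := lt_min H.alpha_pos H.beta_pos

theorem nonneg (H : DEIntegrand f d K α β) : 0 ≤ K := by
  have hmem : (psiReal 0 : ℂ) ∈ psi '' strip d := ⟨0, by simpa [strip] using H.pos, psi_ofReal 0⟩
  refine nonneg_of_mul_nonneg_left ((norm_nonneg _).trans (H.norm_le _ hmem)) ?_
  have hpos := psiReal_pos 0
  have : (1 + psiReal 0 : ℂ) / psiReal 0 ≠ 0 :=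
    mod_cast (by positivity : (1 + psiReal 0) / psiReal 0 ≠ 0)
  rw [norm_E3, norm_exp]
  positivity

theorem differentiableAt_deF (H : DEIntegrand f d K α β) (hζ : ζ ∈ strip d) :
    DifferentiableAt ℂ (deF f) ζ := by
  have hsub := strip_mono H.lt.le
  have hcomp : DifferentiableAt ℂ (fun ζ => f (psi ζ)) ζ :=
    (H.differentiableOn.comp (differentiableOn_psi.mono hsub) (mapsTo_image psi _)).differentiableAt
      ((isOpen_strip d).mem_nhds hζ)
  exact hcomp.mul (DifferentiableAt.mul (by fun_prop) (DifferentiableAt.inv (by fun_prop)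
    (one_add_exp_neg_ne_zero (hsub hζ))))

theorem norm_deF_le (H : DEIntegrand f d K α β) {C : ℝ} (hζ : |ζ.im| ≤ D) (hD : D < d)
    (hC : ‖(1 + psi ζ) / psi ζ * (1 - exp (-psi ζ))‖ ≤ C) :
    ‖deF f ζ‖ ≤ K * (C ^ (1 - α) / kappa D ^ (α + β)) *
      (Real.pi * (Real.cosh ζ.re * deWeight α β (Real.pi * sinh ζ).re)) := by
  have hmem : ζ ∈ strip d := hζ.trans_lt hD
  have hmem' := strip_mono H.lt.le hmem
  have hD' := hD.trans H.lt
  have hK := H.nonneg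
  rw [one_sub_exp_neg_psi hmem'] at hC
  have weight := norm_E3_mul_inv_le H.alpha_pos.le H.alpha_le_one H.beta_pos.le
    (kappa_pos ((abs_nonneg _).trans hζ) hD')
    ((one_add_exp_mul_kappa_le_norm hζ hD').trans_eq (by rw [exp_psi hmem']))
    (one_add_exp_neg_mul_kappa_le_norm hζ hD') hC
  rw [deF, norm_mul, norm_mul, norm_mul, norm_real, Real.norm_of_nonneg Real.pi_pos.le]
  calc _ ≤ (K * ‖E3 α β (psi ζ)‖) * (Real.pi * Real.cosh ζ.re *
        ‖(1 + exp (-(Real.pi * sinh ζ)))⁻¹‖) := by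
        gcongr
        exacts [H.norm_le _ (mem_image_of_mem _ hmem), norm_cosh_le ζ]
    _ = K * (Real.pi * Real.cosh ζ.re) * (‖E3 α β (psi ζ)‖ *
        ‖(1 + exp (-(Real.pi * sinh ζ)))⁻¹‖) := by ring
    _ ≤ K * (Real.pi * Real.cosh ζ.re) * _ := mul_le_mul_of_nonneg_left weight (by positivity)
    _ = _ := by ring

theorem norm_deF_ofReal_le (H : DEIntegrand f d K α β) (t : ℝ) :
    ‖deF f t‖ ≤ K * (13 / 8) ^ (1 - α) *
      (Real.pi * (Real.cosh t * deWeight α β (Real.pi * Real.sinh t))) := by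
  have bound := H.norm_deF_le (by simp) H.pos (norm_one_add_psi_div_mul_ofReal_le t)
  rw [pi_mul_sinh_re] at bound
  simpa [kappa] using bound

theorem norm_deF_line_le (H : DEIntegrand f d K α β) {t y : ℝ} (hy : |y| ≤ D) (hD : D < d) :
    ‖deF f (t + y * I)‖ ≤ K * (cTilde D ^ (1 - α) / kappa D ^ (α + β)) * (Real.pi *
      (Real.cosh t * Real.exp (-(Real.pi * min α β * Real.cos D * |Real.sinh t|)))) := by
  have hD' := hD.trans H.lt
  have hD₀ : 0 ≤ D := (abs_nonneg y).trans hy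
  have him : |(t + y * I : ℂ).im| ≤ D := by simpa using hy
  have hK := H.nonneg
  have := H.mu_pos
  have := kappa_pos hD₀ hD'
  have := cTilde_pos hD₀ hD'
  have hcos : Real.cos D ≤ |Real.cos y| := by
    rw [← Real.cos_abs y]
    exact (Real.cos_le_cos_of_nonneg_of_le_pi (abs_nonneg y) (by linarith) hy).trans (le_abs_self _)
  have hre : (Real.pi * sinh (t + y * I)).re = Real.pi * (Real.sinh t * Real.cos y) := by
    rw [pi_mul_sinh_re]
    simp
  have decay : deWeight α β (Real.pi * sinh (t + y * I)).re ≤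
      Real.exp (-(Real.pi * min α β * Real.cos D * |Real.sinh t|)) := by
    refine (deWeight_le_exp_abs H.alpha_pos.le H.beta_pos.le).trans ?_
    rw [hre, abs_mul, abs_mul, abs_of_pos Real.pi_pos, Real.exp_le_exp, neg_le_neg_iff]
    calc _ = min α β * (Real.pi * (|Real.sinh t| * Real.cos D)) := by ring
      _ ≤ _ := by gcongr
  refine (H.norm_deF_le him hD (norm_one_add_psi_div_mul_le_cTilde him hD')).trans ?_
  rw [show (t + y * I : ℂ).re = t by simp]
  gcongr

theorem stripDecay_deF (H : DEIntegrand f d K α β) (hD₀ : 0 < D) (hD : D < d) :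
    ∃ C : ℝ, StripDecay (deF f) D fun t => C * (1 + t ^ 2)⁻¹ := by
  have := kappa_pos hD₀.le (hD.trans H.lt)
  have := cTilde_pos hD₀.le (hD.trans H.lt)
  have hK := H.nonneg
  have hk : 0 < Real.pi * min α β * Real.cos D := by
    have := cos_pos_of_lt_pi_div_two hD₀.le (hD.trans H.lt)
    have := H.mu_pos
    positivity
  set k := Real.pi * min α β * Real.cos D
  set C := K * (cTilde D ^ (1 - α) / kappa D ^ (α + β)) * (Real.pi * (6 * Real.exp k / k ^ 3))
    with hC
  refine ⟨C, hD₀, fun z hz => H.differentiableAt_deF (hz.trans_lt hD), fun t y hy => ?_,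
    integrable_inv_one_add_sq.const_mul _, ?_⟩
  · refine (H.norm_deF_line_le hy hD).trans ?_
    rw [hC, mul_assoc (K * _), mul_assoc Real.pi (_ / _)]
    gcongr K * _ * (Real.pi * ?_)
    exact cosh_mul_exp_le hk t
  · simpa using tendsto_inv_one_add_sq_cocompact.const_mul C

theorem stripNorm_deF_le (H : DEIntegrand f d K α β) (hD₀ : 0 < D) (hD : D < d) :
    stripNorm (deF f) D ≤ 4 * K / min α β * lineFactor α β D := by
  have hcos := cos_pos_of_lt_pi_div_two hD₀.le (hD.trans H.lt)
  have hμ := H.mu_pos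
  have hk : 0 < Real.pi * min α β * Real.cos D := by positivity
  have line {y : ℝ} (hy : |y| ≤ D) :
      ∫ t : ℝ, ‖deF f (t + y * I)‖ ≤ 2 * K / min α β * lineFactor α β D := by
    refine (integral_mono_of_nonneg (Eventually.of_forall fun _ => norm_nonneg _)
      (((integrable_cosh_mul_exp_abs hk).const_mul Real.pi).const_mul _)
      (Eventually.of_forall fun t => H.norm_deF_line_le hy hD)).trans_eq ?_
    rw [integral_const_mul, integral_const_mul, integral_cosh_mul_exp_abs hk, lineFactor]
    field_simp
  have hD_abs : |D| = D := abs_of_pos hD₀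
  calc stripNorm (deF f) D
      ≤ 2 * K / min α β * lineFactor α β D + 2 * K / min α β * lineFactor α β D :=
        add_le_add (line (by rw [abs_neg, hD_abs])) (line hD_abs.le)
    _ = _ := by ring

theorem summable_deF (H : DEIntegrand f d K α β) {h : ℝ} (hh : h ≠ 0) :
    Summable fun k : ℤ => deF f (k * h : ℝ) := by
  obtain ⟨C, S⟩ := H.stripDecay_deF (half_pos H.pos) (half_lt_self H.pos)
  refine .of_norm_bounded ((summable_inv_one_add_sq_nodes hh).mul_left C) fun k => ?_
  simpa using S.norm_le (k * h) 0 (by simpa using S.pos.le)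

theorem discretization_error (H : DEIntegrand f d K α β) {h : ℝ} (hh : 0 < h) (b : ℝ) :
    ‖(∫ x in Iic b, deF f (x : ℂ)) - ∑' k : ℤ, deF f (k * h : ℝ) * (J k h b : ℝ)‖ ≤
      K / (min α β * d) * lineFactor α β d * (h * (Real.sinh (Real.pi / h * d))⁻¹) := by
  have hd := H.pos
  have hμ := H.mu_pos
  have smaller {D : ℝ} (hD₀ : 0 < D) (hD : D < d) :
      ‖(∫ x in Iic b, deF f (x : ℂ)) - ∑' k : ℤ, deF f (k * h : ℝ) * (J k h b : ℝ)‖ ≤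
        K / (min α β * D) * lineFactor α β D * (h * (Real.sinh (Real.pi / h * D))⁻¹) := by
    obtain ⟨C, S⟩ := H.stripDecay_deF hD₀ hD
    have : 0 < Real.sinh (Real.pi / h * D) := Real.sinh_pos_iff.2 (by positivity)
    calc _ ≤ stripNorm (deF f) D * (h / (4 * D) * (Real.sinh (Real.pi / h * D))⁻¹) :=
          S.discretization_error hh (H.summable_deF hh.ne') b
      _ ≤ 4 * K / min α β * lineFactor α β D *
            (h / (4 * D) * (Real.sinh (Real.pi / h * D))⁻¹) := by
          gcongr
          exact H.stripNorm_deF_le hD₀ hD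
      _ = _ := by field_simp
  have hsinh : Real.sinh (Real.pi / h * d) ≠ 0 := (Real.sinh_pos_iff.2 (by positivity)).ne'
  have hcont : ContinuousAt (fun D => K / (min α β * D) * lineFactor α β D *
      (h * (Real.sinh (Real.pi / h * D))⁻¹)) d := by
    refine ((continuousAt_const.div (by fun_prop) (by positivity)).mul
      (continuousAt_lineFactor α β hd.le H.lt)).mul (continuousAt_const.mul (.inv₀ ?_ hsinh))
    exact Real.continuous_sinh.continuousAt.comp (by fun_prop)
  refine ge_of_tendsto (hcont.tendsto.mono_left (nhdsWithin_le_nhds (s := Iio d))) ?_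
  filter_upwards [self_mem_nhdsWithin, mem_nhdsWithin_of_mem_nhds (Ioi_mem_nhds hd)]
    with D hD hD₀ using smaller hD₀ hD

end DEIntegrand

section Truncation

variable {E : Type*} [NormedAddCommGroup E] {a : ℤ → E} {M N : ℤ} {c h : ℝ}

theorem cosh_mul_one_sub_exp_neg_le (x h : ℝ) :
    Real.cosh x * (1 - Real.exp (-h)) ≤ Real.sinh x - Real.sinh (x - h) := by
  have gap : Real.sinh x - Real.sinh (x - h) =
      Real.cosh x * (1 - Real.exp (-h)) + Real.exp (-x) * (Real.cosh h - 1) := by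
    rw [Real.sinh_sub, Real.cosh_eq h, Real.sinh_eq h, Real.cosh_eq x, Real.sinh_eq x]
    ring
  have := sub_nonneg.2 (Real.one_le_cosh h)
  rw [gap]
  exact le_add_of_nonneg_right (by positivity)

theorem cosh_mul_exp_le_sub (hc : 0 ≤ c) (x h : ℝ) :
    Real.cosh x * Real.exp (-(c * Real.sinh x)) * (c * (1 - Real.exp (-h))) ≤
      Real.exp (-(c * Real.sinh (x - h))) - Real.exp (-(c * Real.sinh x)) := by
  set δ := Real.sinh x - Real.sinh (x - h) with hδ
  have shift : Real.exp (-(c * Real.sinh (x - h))) =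
      Real.exp (-(c * Real.sinh x)) * Real.exp (c * δ) := by
    rw [← Real.exp_add, hδ]
    ring_nf
  calc _ = Real.exp (-(c * Real.sinh x)) * (c * (Real.cosh x * (1 - Real.exp (-h)))) := by ring
    _ ≤ Real.exp (-(c * Real.sinh x)) * (Real.exp (c * δ) - 1) := by
        gcongr
        have := mul_le_mul_of_nonneg_left (cosh_mul_one_sub_exp_neg_le x h) hc
        linarith [Real.add_one_le_exp (c * δ)]
    _ = _ := by rw [shift]; ring

theorem sum_cosh_mul_exp_le (hc : 0 < c) (hh : 0 < h) (x : ℝ) (p : ℕ) :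
    ∑ j ∈ Finset.range p, Real.cosh (x + (j + 1) * h) *
        Real.exp (-(c * Real.sinh (x + (j + 1) * h))) ≤
      Real.exp (-(c * Real.sinh x)) / (c * (1 - Real.exp (-h))) := by
  have : 0 < 1 - Real.exp (-h) := by simpa
  rw [le_div_iff₀ (by positivity), Finset.sum_mul]
  set u : ℕ → ℝ := fun j => Real.exp (-(c * Real.sinh (x + j * h))) with hu
  have telescope : ∀ j ∈ Finset.range p, Real.cosh (x + (j + 1) * h) *
      Real.exp (-(c * Real.sinh (x + (j + 1) * h))) * (c * (1 - Real.exp (-h))) ≤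
        u j - u (j + 1) := by
    intro j _
    have := cosh_mul_exp_le_sub hc.le (x + (j + 1) * h) h
    rw [show x + (j + 1) * h - h = x + j * h by ring] at this
    simpa [hu] using this
  calc _ ≤ ∑ j ∈ Finset.range p, (u j - u (j + 1)) := Finset.sum_le_sum telescope
    _ = u 0 - u p := Finset.sum_range_sub' u p
    _ ≤ u 0 := sub_le_self _ (Real.exp_pos _).le
    _ = _ := by simp [hu]

theorem sum_norm_le_of_cosh_mul_exp {F : ℕ → E} {A γ x : ℝ} (hA : 0 ≤ A) (hγ : 0 < γ) (hh : 0 < h)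
    (hF : ∀ j : ℕ, ‖F j‖ ≤ A * (Real.pi * (Real.cosh (x + (j + 1) * h) *
      Real.exp (-(γ * (Real.pi * Real.sinh (x + (j + 1) * h))))))) (p : ℕ) :
    ∑ j ∈ Finset.range p, ‖F j‖ ≤
      A / (1 - Real.exp (-h)) * (Real.exp (-(Real.pi * γ * Real.sinh x)) / γ) := by
  have : 0 < 1 - Real.exp (-h) := by simpa
  calc _ ≤ ∑ j ∈ Finset.range p, A * Real.pi * (Real.cosh (x + (j + 1) * h) *
          Real.exp (-(Real.pi * γ * Real.sinh (x + (j + 1) * h)))) :=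
        Finset.sum_le_sum fun j _ => (hF j).trans_eq (by ring_nf)
    _ ≤ A * Real.pi * (Real.exp (-(Real.pi * γ * Real.sinh x)) /
          (Real.pi * γ * (1 - Real.exp (-h)))) := by
        rw [← Finset.mul_sum]
        gcongr
        exact sum_cosh_mul_exp_le (by positivity) hh x p
    _ = _ := by field_simp

theorem norm_sum_Icc_sub_sum_Icc_le (a : ℤ → E) (hMN : -M ≤ N) (p : ℕ) :
    ‖∑ k ∈ Finset.Icc (-(M + p)) (N + p), a k - ∑ k ∈ Finset.Icc (-M) N, a k‖ ≤
      ∑ j ∈ Finset.range p, (‖a (N + 1 + j)‖ + ‖a (-(M + 1 + j))‖) := by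
  induction p with
  | zero => simp
  | succ p ih =>
    have hunion : Finset.Icc (-(M + ((p + 1 : ℕ) : ℤ))) (N + ((p + 1 : ℕ) : ℤ)) =
        Finset.Icc (-(M + p)) (N + p) ∪ {N + 1 + (p : ℤ), -(M + 1 + (p : ℤ))} := by
      ext k
      simp only [Finset.mem_Icc, Finset.mem_union, Finset.mem_insert, Finset.mem_singleton]
      omega
    have hdisj : Disjoint (Finset.Icc (-(M + p)) (N + p))
        ({N + 1 + (p : ℤ), -(M + 1 + (p : ℤ))} : Finset ℤ) := by
      simp only [Finset.disjoint_insert_right, Finset.disjoint_singleton_right, Finset.mem_Icc]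
      omega
    rw [hunion, Finset.sum_union hdisj, Finset.sum_pair (by omega), Finset.sum_range_succ,
      add_sub_right_comm]
    exact (norm_add_le _ _).trans (add_le_add ih (norm_add_le _ _))

theorem tendsto_Icc_neg_add_add (M N : ℤ) :
    Tendsto (fun p : ℕ => Finset.Icc (-(M + (p : ℤ))) (N + p)) atTop atTop := by
  refine tendsto_atTop_finset_of_monotone
    (fun p q hpq => Finset.Icc_subset_Icc (by omega) (by omega))
    fun k => ⟨k.natAbs + M.natAbs + N.natAbs, ?_⟩
  rw [Finset.mem_Icc]
  omega

theorem norm_tsum_sub_sum_Icc_le (ha : Summable a) (hMN : -M ≤ N) {A B : ℝ}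
    (hA : ∀ p : ℕ, ∑ j ∈ Finset.range p, ‖a (N + 1 + j)‖ ≤ A)
    (hB : ∀ p : ℕ, ∑ j ∈ Finset.range p, ‖a (-(M + 1 + j))‖ ≤ B) :
    ‖∑' k, a k - ∑ k ∈ Finset.Icc (-M) N, a k‖ ≤ A + B := by
  have hsum : Tendsto (fun s : Finset ℤ => ∑ k ∈ s, a k) atTop (𝓝 (∑' k, a k)) := ha.hasSum
  refine le_of_tendsto ((hsum.comp (tendsto_Icc_neg_add_add M N)).sub_const _).norm
    (.of_forall fun p => (norm_sum_Icc_sub_sum_Icc_le a hMN p).trans ?_)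
  rw [Finset.sum_add_distrib]
  exact add_le_add (hA p) (hB p)

theorem DEIntegrand.truncation_error {f : ℂ → ℂ} {d K α β : ℝ} (H : DEIntegrand f d K α β)
    (hh : 0 < h) (b : ℝ) (hMN : -M ≤ N) :
    ‖∑' k : ℤ, deF f (k * h : ℝ) * (J k h b : ℝ) -
        ∑ k ∈ Finset.Icc (-M) N, deF f (k * h : ℝ) * (J k h b : ℝ)‖ ≤
      K * (13 / 8) ^ (1 - α) * (h * (1 + Real.pi⁻¹ ^ 2)) / (1 - Real.exp (-h)) *
        (Real.exp (-(Real.pi * β * Real.sinh (N * h))) / β +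
          Real.exp (-(Real.pi * α * Real.sinh (M * h))) / α) := by
  have hK := H.nonneg
  have term_le : ∀ (k : ℤ) (X : ℝ), ‖deF f (k * h : ℝ)‖ ≤ X →
      ‖deF f (k * h : ℝ) * (J k h b : ℝ)‖ ≤ X * (h * (1 + Real.pi⁻¹ ^ 2)) := fun k X hX => by
    rw [norm_mul, norm_real, Real.norm_eq_abs]
    exact mul_le_mul hX (abs_J_le k hh.le b) (abs_nonneg _) ((norm_nonneg _).trans hX)
  have hsum : Summable fun k : ℤ => deF f (k * h : ℝ) * (J k h b : ℝ) :=
    .of_norm_bounded ((H.summable_deF hh.ne').norm.mul_right _) fun k => term_le k _ le_rfl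
  rw [mul_add]
  refine norm_tsum_sub_sum_Icc_le hsum hMN
    (sum_norm_le_of_cosh_mul_exp (by positivity) H.beta_pos hh fun j => ?_)
    (sum_norm_le_of_cosh_mul_exp (by positivity) H.alpha_pos hh fun j => ?_)
  · refine (term_le _ _ (H.norm_deF_ofReal_le _)).trans ?_
    rw [mul_right_comm, show ((N + 1 + j : ℤ) : ℝ) * h = N * h + (j + 1) * h by push_cast; ring]
    gcongr
    exact deWeight_le_exp_neg H.alpha_pos.le H.beta_pos.le
  · refine (term_le _ _ (H.norm_deF_ofReal_le _)).trans ?_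
    rw [mul_right_comm, show ((-(M + 1 + j) : ℤ) : ℝ) * h = -(M * h + (j + 1) * h) by
      push_cast; ring, Real.cosh_neg, Real.sinh_neg, mul_neg, deWeight_neg]
    gcongr
    exact deWeight_le_exp_neg H.beta_pos.le H.alpha_pos.le

end Truncation

section Constants

variable {α β γ μ y L X : ℝ}

theorem one_le_log_div (hγ : 0 < γ) (hy : γ * Real.exp 1 ≤ 2 * y) : 1 ≤ Real.log (2 * y / γ) := by
  have : 0 < 2 * y := lt_of_lt_of_le (by positivity) hy
  rw [Real.le_log_iff_exp_le (by positivity), le_div_iff₀ hγ]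
  linarith

theorem sub_le_mul_sinh (hγ : 0 < γ) (hy : γ * Real.exp 1 ≤ 2 * y)
    (hX : Real.log (2 * y / γ) ≤ X) : y - γ / (2 * Real.exp 1) ≤ γ * Real.sinh X := by
  have hy₀ : 0 < y := by
    have : 0 < γ * Real.exp 1 := by positivity
    linarith
  calc y - γ / (2 * Real.exp 1) ≤ y - γ ^ 2 / (4 * y) := by
        gcongr y - ?_
        rw [div_le_div_iff₀ (by positivity) (by positivity)]
        nlinarith
    _ = γ * Real.sinh (Real.log (2 * y / γ)) := by
        rw [Real.sinh_log (by positivity)]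
        field_simp
        ring
    _ ≤ γ * Real.sinh X := by gcongr; exact Real.sinh_le_sinh.2 hX

theorem exp_neg_mul_sinh_div_le {s : ℝ} (hμ : 0 < μ) (hμγ : μ ≤ γ) (hγs : γ ≤ s)
    (hy : γ * Real.exp 1 ≤ 2 * y) (hX : Real.log (2 * y / γ) ≤ X) :
    Real.exp (-(Real.pi * γ * Real.sinh X)) / γ ≤
      Real.exp (-(Real.pi * y)) * Real.exp (Real.pi * s / (2 * Real.exp 1)) / μ := by
  rw [← Real.exp_add]
  gcongr
  calc -(Real.pi * γ * Real.sinh X) = -(Real.pi * (γ * Real.sinh X)) := by ring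
    _ ≤ -(Real.pi * (y - γ / (2 * Real.exp 1))) := by
        gcongr
        exact sub_le_mul_sinh (hμ.trans_le hμγ) hy hX
    _ ≤ -(Real.pi * (y - s / (2 * Real.exp 1))) := by gcongr
    _ = _ := by ring

theorem one_sub_exp_neg_mul_le (x : ℝ) (n : ℕ) :
    1 - Real.exp (-(n * x)) ≤ n * (1 - Real.exp (-x)) := by
  have bernoulli := one_add_mul_le_pow (a := Real.exp (-x) - 1)
    (by linarith [Real.exp_pos (-x)]) n
  rw [add_sub_cancel, ← Real.exp_nat_mul, mul_neg] at bernoulli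
  linarith

theorem one_add_inv_pi_sq_mul_le (hy : 0 ≤ y) :
    (1 + Real.pi⁻¹ ^ 2) * (y / (1 - Real.exp (-1))) ≤
      Real.exp (Real.pi / 12 - 1 / 2 + 0.87 * y) := by
  have hpi := Real.pi_gt_d2
  have hinv : Real.pi⁻¹ ≤ 0.319 := (inv_le_comm₀ Real.pi_pos (by norm_num)).2 (by linarith)
  have hden : 0.632 ≤ 1 - Real.exp (-1) := by linarith [Real.exp_neg_one_lt_d9]
  have hexp : 0.76 ≤ Real.exp (Real.pi / 12 - 1 / 2) := by
    linarith [Real.add_one_le_exp (Real.pi / 12 - 1 / 2)]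
  have hlin : 2.718 * (0.87 * y) ≤ Real.exp (0.87 * y) :=
    le_trans (by gcongr; linarith [Real.exp_one_gt_d9]) Real.exp_one_mul_le_exp
  calc (1 + Real.pi⁻¹ ^ 2) * (y / (1 - Real.exp (-1))) ≤ (1 + 0.319 ^ 2) * (y / 0.632) := by
        gcongr
    _ ≤ 0.76 * (2.718 * (0.87 * y)) := by norm_num1; linarith
    _ ≤ _ := by rw [Real.exp_add]; gcongr

theorem rpow_le_exp_half_mul {s : ℝ} (hs : 0 ≤ s) : ((13 : ℝ) / 8) ^ s ≤ Real.exp (1 / 2 * s) := by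
  rw [Real.exp_mul]
  gcongr
  have := Real.quadratic_le_exp_of_nonneg (x := 1 / 2) (by norm_num)
  linarith

-- The weight `2.44 = 2 * 1.22` is dictated by the use in `truncation_constant_le`: there
-- `2 y exp (-L) ≤ α`, and the target exponent leaves at least `1.22 α` after the other factors.
theorem le_pi_mul_one_sub_inv_add_exp_neg (hL : 1 ≤ L) :
    0.87 ≤ Real.pi * (1 - L⁻¹) + 2.44 * Real.exp (-L) := by
  have hpi := Real.pi_gt_d2
  rcases le_total L 3 with h3 | h3
  · have hchord : (L - 1) / 3 ≤ 1 - L⁻¹ := by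
      rw [← sub_nonneg, show 1 - L⁻¹ - (L - 1) / 3 = (L - 1) * (3 - L) / (3 * L) by
        field_simp]
      exact div_nonneg (mul_nonneg (by linarith) (by linarith)) (by linarith)
    have htangent : 0.367 * (2 - L) ≤ Real.exp (-L) := by
      have hsplit : Real.exp (-L) = Real.exp (-1) * Real.exp (1 - L) := by
        rw [← Real.exp_add]
        ring_nf
      have := mul_le_mul_of_nonneg_left (Real.add_one_le_exp (1 - L)) (Real.exp_pos (-1)).le
      nlinarith [Real.exp_neg_one_gt_d9, Real.exp_pos (-L)]
    nlinarith
  · have : L⁻¹ ≤ 3⁻¹ := by gcongr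
    nlinarith [Real.exp_pos (-L)]

theorem pi_mul_div_two_mul_exp_one_le {s : ℝ} (hs : 0 ≤ s) :
    Real.pi * s / (2 * Real.exp 1) ≤ 0.184 * (Real.pi * s) := by
  have : 0 ≤ Real.pi * s := by positivity
  rw [div_le_iff₀ (by positivity)]
  nlinarith [Real.exp_one_gt_d9]

theorem truncation_constant_le (hα : α ≤ 1) (hβ : 0 ≤ β) (hy : 0 < y) (hL : 1 ≤ L)
    (hμ : 2 * y * Real.exp (-L) ≤ α) :
    (1 + Real.pi⁻¹ ^ 2) * (13 / 8) ^ (1 - α) * (y / (1 - Real.exp (-1))) *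
        Real.exp (-(Real.pi * y * (1 - L⁻¹))) * Real.exp (Real.pi * (α + β) / (2 * Real.exp 1)) ≤
      Real.exp (Real.pi * (1 + 5 * α + 6 * β) / 12) := by
  have hpi := Real.pi_gt_d2
  have hα₀ : 0 < α := lt_of_lt_of_le (by positivity) hμ
  have : 0 < 1 - Real.exp (-1) := by simp
  have hy_le : 0.87 * y ≤ Real.pi * y * (1 - L⁻¹) + 1.22 * α := by
    have := mul_le_mul_of_nonneg_left (le_pi_mul_one_sub_inv_add_exp_neg hL) hy.le
    linarith
  calc _ = (1 + Real.pi⁻¹ ^ 2) * (y / (1 - Real.exp (-1))) * (13 / 8) ^ (1 - α) *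
          Real.exp (-(Real.pi * y * (1 - L⁻¹))) *
            Real.exp (Real.pi * (α + β) / (2 * Real.exp 1)) := by ring
    _ ≤ Real.exp (Real.pi / 12 - 1 / 2 + 0.87 * y) * Real.exp (1 / 2 * (1 - α)) *
          Real.exp (-(Real.pi * y * (1 - L⁻¹))) * Real.exp (0.184 * (Real.pi * (α + β))) := by
        gcongr
        · exact one_add_inv_pi_sq_mul_le hy.le
        · exact rpow_le_exp_half_mul (by linarith)
        · exact pi_mul_div_two_mul_exp_one_le (by linarith)
    _ ≤ _ := by
        simp only [← Real.exp_add]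
        gcongr
        nlinarith

theorem inv_sinh_le {c u : ℝ} (hc : 0 < c) (hcu : c ≤ 2 * u) :
    (Real.sinh u)⁻¹ ≤ 2 * Real.exp (-u) / (1 - Real.exp (-c)) := by
  have hc' : 0 < 1 - Real.exp (-c) := by simpa
  have hu : Real.exp (-u) * Real.exp u = 1 := by simp [← Real.exp_add]
  have hcu' : Real.exp (-u) * Real.exp (-u) ≤ Real.exp (-c) := by
    rw [← Real.exp_add]
    gcongr
    linarith
  have hsinh : 0 < Real.sinh u := Real.sinh_pos_iff.2 (by linarith)
  rw [inv_le_iff_one_le_mul₀ hsinh, div_mul_eq_mul_div, le_div_iff₀ hc', Real.sinh_eq]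
  linarith

end Constants

section Parameters

variable {d K α β μ h y L : ℝ} {n : ℕ}

theorem log_le_sub_floor_mul {c : ℝ} (hα : 0 < α) (hβ : 0 < β) (hh : 0 < h) (hc : 0 < c)
    (hnh : n * h = Real.log (c / α)) :
    Real.log (c / β) ≤ (n - ⌊Real.log (β / α) / h⌋ : ℤ) * h := by
  have hfloor : (⌊Real.log (β / α) / h⌋ : ℝ) * h ≤ Real.log (β / α) :=
    (le_div_iff₀ hh).1 (Int.floor_le _)
  rw [Real.log_div hβ.ne' hα.ne'] at hfloor
  rw [Real.log_div hc.ne' hα.ne'] at hnh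
  rw [Real.log_div hc.ne' hβ.ne']
  push_cast [Real.log_div hβ.ne' hα.ne']
  linarith

theorem log_le_lowerM_mul {c : ℝ} (hα : 0 < α) (hβ : 0 < β) (hh : 0 < h) (hc : 0 < c)
    (hnh : n * h = Real.log (c / min α β)) : Real.log (c / α) ≤ lowerM α β h n * h := by
  unfold lowerM
  split_ifs with hαβ
  · rw [min_eq_left hαβ] at hnh
    exact_mod_cast hnh.ge
  · rw [min_eq_right (not_le.1 hαβ).le] at hnh
    exact log_le_sub_floor_mul hβ hα hh hc hnh

theorem log_le_upperN_mul {c : ℝ} (hα : 0 < α) (hβ : 0 < β) (hh : 0 < h) (hc : 0 < c)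
    (hnh : n * h = Real.log (c / min α β)) : Real.log (c / β) ≤ upperN α β h n * h := by
  unfold upperN
  split_ifs with hαβ
  · rw [min_eq_left hαβ] at hnh
    exact log_le_sub_floor_mul hα hβ hh hc hnh
  · rw [min_eq_right (not_le.1 hαβ).le] at hnh
    exact_mod_cast hnh.ge

theorem epsDE_two_mul (hh : h = Real.log (2 * (d * n) / μ) / n) :
    epsDE d (2 * μ) n = h * Real.exp (-(Real.pi / h * d)) := by
  have harg : 4 * d * n / (2 * μ) = 2 * (d * n) / μ := by ring
  rw [epsDE, harg, hh, div_div_eq_mul_div]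
  ring_nf

theorem errConst_eq (d K α β : ℝ) : errConst d K α β = 2 * K / (min α β * d) *
    (lineFactor α β d / (1 - Real.exp (-(Real.pi * min α β * Real.exp 1))) +
      Real.exp (Real.pi * (1 + 5 * α + 6 * β) / 12)) := by
  rw [errConst, lineFactor, kappa, div_div]
  ring_nf

theorem pi_mul_mul_exp_one_le (hμ : 0 < μ) (hn : μ * Real.exp 1 ≤ 2 * (d * n))
    (hh : h = Real.log (2 * (d * n) / μ) / n) :
    Real.pi * μ * Real.exp 1 ≤ 2 * (Real.pi / h * d) := by
  have hL := one_le_log_div hμ hn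
  set L := Real.log (2 * (d * n) / μ)
  have hdn : 0 < 2 * (d * n) := lt_of_lt_of_le (by positivity) hn
  have hexp : Real.exp 1 * L ≤ 2 * (d * n) / μ :=
    Real.exp_one_mul_le_exp.trans_eq (Real.exp_log (by positivity))
  rw [le_div_iff₀ hμ] at hexp
  calc Real.pi * μ * Real.exp 1 ≤ Real.pi * (2 * (d * n)) / L := by
        rw [le_div_iff₀ (by positivity)]
        nlinarith [Real.pi_pos]
    _ = _ := by rw [hh, div_div_eq_mul_div]; ring

theorem div_one_sub_exp_neg_le (hd : 0 ≤ d) (hn : 0 < n) (hnh : 1 ≤ n * h) :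
    d / (1 - Real.exp (-h)) ≤ d * n / (1 - Real.exp (-1)) := by
  have : 0 < h := pos_of_mul_pos_right (one_pos.trans_le hnh) n.cast_nonneg
  have : 0 < 1 - Real.exp (-1) := by simp
  rw [← div_div_eq_mul_div]
  gcongr
  rw [div_le_iff₀' (by positivity)]
  refine le_trans ?_ (one_sub_exp_neg_mul_le h n)
  gcongr

theorem exp_neg_pi_mul_eq (hh : h = L / n) (hh₀ : h ≠ 0) :
    Real.exp (-(Real.pi * (d * n))) =
      Real.exp (-(Real.pi * (d * n) * (1 - L⁻¹))) * Real.exp (-(Real.pi / h * d)) := by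
  obtain ⟨hL, hn⟩ := div_ne_zero_iff.1 (hh ▸ hh₀)
  rw [← Real.exp_add, hh]
  congr 1
  field_simp
  ring

theorem exp_neg_mul_sinh_div_add_le {X Y : ℝ} (hα : 0 < α) (hβ : 0 < β)
    (hy : max α β * Real.exp 1 ≤ 2 * y)
    (hX : Real.log (2 * y / α) ≤ X) (hY : Real.log (2 * y / β) ≤ Y) :
    Real.exp (-(Real.pi * β * Real.sinh Y)) / β + Real.exp (-(Real.pi * α * Real.sinh X)) / α ≤
      2 * (Real.exp (-(Real.pi * y)) *
        Real.exp (Real.pi * (α + β) / (2 * Real.exp 1)) / min α β) := by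
  have hμ : 0 < min α β := lt_min hα hβ
  rw [two_mul]
  gcongr ?_ + ?_
  · exact exp_neg_mul_sinh_div_le hμ (min_le_right α β) (le_add_of_nonneg_left hα.le)
      (le_trans (by gcongr; exact le_max_right α β) hy) hY
  · exact exp_neg_mul_sinh_div_le hμ (min_le_left α β) (le_add_of_nonneg_right hβ.le)
      (le_trans (by gcongr; exact le_max_left α β) hy) hX

theorem truncation_bound_le {X Y : ℝ} (hd : 0 < d) (hK : 0 ≤ K) (hα : 0 < α) (hα₁ : α ≤ 1)
    (hβ : 0 < β) (hn₀ : 0 < n) (hn : max α β * Real.exp 1 ≤ 2 * (d * n))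
    (hh : h = Real.log (2 * (d * n) / min α β) / n)
    (hX : Real.log (2 * (d * n) / α) ≤ X) (hY : Real.log (2 * (d * n) / β) ≤ Y) :
    K * (13 / 8) ^ (1 - α) * (h * (1 + Real.pi⁻¹ ^ 2)) / (1 - Real.exp (-h)) *
        (Real.exp (-(Real.pi * β * Real.sinh Y)) / β +
          Real.exp (-(Real.pi * α * Real.sinh X)) / α) ≤
      2 * K / (min α β * d) * Real.exp (Real.pi * (1 + 5 * α + 6 * β) / 12) *
        (h * Real.exp (-(Real.pi / h * d))) := by
  have hμ : 0 < min α β := lt_min hα hβ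
  have hμα := min_le_left α β
  have tails := exp_neg_mul_sinh_div_add_le hα hβ hn hX hY
  have hL : 1 ≤ Real.log (2 * (d * n) / min α β) :=
    one_le_log_div hμ (le_trans (by gcongr; exact min_le_max) hn)
  set μ := min α β
  set L := Real.log (2 * (d * n) / μ) with hLdef
  have hh₀ : 0 < h := by rw [hh]; positivity
  have hnh : n * h = L := by rw [hh]; field_simp
  have hμL : 2 * (d * n) * Real.exp (-L) = μ := by
    rw [Real.exp_neg, hLdef, Real.exp_log (by positivity)]
    field_simp
  have : 0 < 1 - Real.exp (-h) := by simpa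
  rw [exp_neg_pi_mul_eq hh hh₀.ne'] at tails
  set A := Real.exp (-(Real.pi * (d * n) * (1 - L⁻¹)))
  set E := Real.exp (-(Real.pi / h * d))
  set S := Real.exp (Real.pi * (α + β) / (2 * Real.exp 1))
  calc _ ≤ K * (13 / 8) ^ (1 - α) * (h * (1 + Real.pi⁻¹ ^ 2)) / (1 - Real.exp (-h)) *
        (2 * (A * E * S / μ)) := by gcongr
    _ = 2 * K / (μ * d) * ((1 + Real.pi⁻¹ ^ 2) * (13 / 8) ^ (1 - α) *
          (d / (1 - Real.exp (-h))) * A * S) * (h * E) := by field_simp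
    _ ≤ 2 * K / (μ * d) * ((1 + Real.pi⁻¹ ^ 2) * (13 / 8) ^ (1 - α) *
          (d * n / (1 - Real.exp (-1))) * A * S) * (h * E) := by
        gcongr _ * (_ * ?_ * A * S) * _
        exact div_one_sub_exp_neg_le hd.le hn₀ (hL.trans_eq hnh.symm)
    _ ≤ _ := by
        gcongr
        exact truncation_constant_le hα₁ hβ.le (by positivity) hL (hμL.trans_le hμα)

end Parameters

section Substitution

theorem hasDerivAt_psiReal (x : ℝ) :
    HasDerivAt psiReal (Real.pi * Real.cosh x * (1 + Real.exp (-(Real.pi * Real.sinh x)))⁻¹) x := by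
  refine ((((Real.hasDerivAt_sinh x).const_mul Real.pi).exp.const_add 1).log
    (by positivity)).congr_deriv ?_
  rw [Real.exp_neg]
  field_simp
  ring

theorem deriv_psiReal_pos (x : ℝ) : 0 < deriv psiReal x := by
  rw [(hasDerivAt_psiReal x).deriv]
  positivity

theorem strictMono_psiReal : StrictMono psiReal := strictMono_of_deriv_pos deriv_psiReal_pos

theorem deF_ofReal (f : ℂ → ℂ) (x : ℝ) :
    deF f x = f (psiReal x : ℝ) * (deriv psiReal x : ℝ) := by
  rw [(hasDerivAt_psiReal x).deriv, deF, psi_ofReal]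
  push_cast
  rfl

theorem image_psiReal_Iic {τ : ℝ} (hτ : 0 < τ) : psiReal '' Iic (psiInv τ) = Ioc 0 τ := by
  ext t
  constructor
  · rintro ⟨x, hx, rfl⟩
    exact ⟨psiReal_pos x, (strictMono_psiReal.monotone hx).trans_eq (psiReal_psiInv hτ)⟩
  · rintro ⟨ht₀, ht⟩
    refine ⟨psiInv t, strictMono_psiReal.le_iff_le.1 ?_, psiReal_psiInv ht₀⟩
    rwa [psiReal_psiInv ht₀, psiReal_psiInv hτ]

theorem abs_deriv_psiReal_smul (f : ℂ → ℂ) (x : ℝ) :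
    |deriv psiReal x| • f (psiReal x : ℝ) = deF f x := by
  rw [abs_of_pos (deriv_psiReal_pos x), deF_ofReal, real_smul, mul_comm]

variable {f : ℂ → ℂ} {τ : ℝ}

theorem hasDerivWithinAt_psiReal {s : Set ℝ} :
    ∀ x ∈ s, HasDerivWithinAt psiReal (deriv psiReal x) s x := fun x _ =>
  (hasDerivAt_psiReal x).differentiableAt.hasDerivAt.hasDerivWithinAt

theorem intervalIntegrable_of_integrable_deF (hF : Integrable fun x : ℝ => deF f x) (hτ : 0 < τ) :
    IntervalIntegrable (fun t : ℝ => f t) volume 0 τ := by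
  rw [intervalIntegrable_iff_integrableOn_Ioc_of_le hτ.le, ← image_psiReal_Iic hτ,
    integrableOn_image_iff_integrableOn_abs_deriv_smul measurableSet_Iic hasDerivWithinAt_psiReal
      strictMono_psiReal.injective.injOn]
  simp_rw [abs_deriv_psiReal_smul]
  exact hF.integrableOn

theorem intervalIntegral_eq_integral_deF (f : ℂ → ℂ) (hτ : 0 < τ) :
    ∫ t in (0 : ℝ)..τ, f t = ∫ x in Iic (psiInv τ), deF f (x : ℂ) := by
  rw [intervalIntegral.integral_of_le hτ.le, ← image_psiReal_Iic hτ,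
    integral_image_eq_integral_abs_deriv_smul measurableSet_Iic hasDerivWithinAt_psiReal
      strictMono_psiReal.injective.injOn]
  simp_rw [abs_deriv_psiReal_smul]

end Substitution

section ErrorBound

variable {f : ℂ → ℂ} {d K α β h : ℝ} {n : ℕ} {M N : ℤ}

theorem step_pos (hα : 0 < α) (hβ : 0 < β) (hn₀ : 0 < n)
    (hn : max α β * Real.exp 1 ≤ 2 * (d * n))
    (hh : h = Real.log (2 * (d * n) / min α β) / n) : 0 < h := by
  have hL : 1 ≤ Real.log (2 * (d * n) / min α β) :=
    one_le_log_div (lt_min hα hβ) (le_trans (by gcongr; exact min_le_max) hn)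
  rw [hh]
  positivity

theorem neg_le_of_log_le (hα : 0 < α) (hβ : 0 < β) (hh : 0 < h)
    (hn : max α β * Real.exp 1 ≤ 2 * (d * n)) (hM : Real.log (2 * (d * n) / α) ≤ M * h)
    (hN : Real.log (2 * (d * n) / β) ≤ N * h) : -M ≤ N := by
  have hM₀ : (0 : ℝ) < M := pos_of_mul_pos_left (one_pos.trans_le ((one_le_log_div hα
    (le_trans (by gcongr; exact le_max_left α β) hn)).trans hM)) hh.le
  have hN₀ : (0 : ℝ) < N := pos_of_mul_pos_left (one_pos.trans_le ((one_le_log_div hβ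
    (le_trans (by gcongr; exact le_max_right α β) hn)).trans hN)) hh.le
  rw [Int.cast_pos] at hM₀ hN₀
  omega

theorem DEIntegrand.discretization_error_le (H : DEIntegrand f d K α β) (hn₀ : 0 < n)
    (hn : max α β * Real.exp 1 ≤ 2 * (d * n))
    (hh : h = Real.log (2 * (d * n) / min α β) / n) (b : ℝ) :
    ‖(∫ x in Iic b, deF f (x : ℂ)) - ∑' k : ℤ, deF f (k * h : ℝ) * (J k h b : ℝ)‖ ≤
      2 * K / (min α β * d) * (lineFactor α β d /
        (1 - Real.exp (-(Real.pi * min α β * Real.exp 1)))) *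
          (h * Real.exp (-(Real.pi / h * d))) := by
  have hμ := H.mu_pos
  have hd := H.pos
  have hK := H.nonneg
  have hlf := lineFactor_pos α β hd.le H.lt
  have hh₀ := step_pos H.alpha_pos H.beta_pos hn₀ hn hh
  calc _ ≤ K / (min α β * d) * lineFactor α β d * (h * (Real.sinh (Real.pi / h * d))⁻¹) :=
        H.discretization_error hh₀ b
    _ ≤ K / (min α β * d) * lineFactor α β d * (h * (2 * Real.exp (-(Real.pi / h * d)) /
          (1 - Real.exp (-(Real.pi * min α β * Real.exp 1))))) := by
        gcongr
        exact inv_sinh_le (by positivity) (pi_mul_mul_exp_one_le hμ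
          (le_trans (by gcongr; exact min_le_max) hn) hh)
    _ = _ := by ring

theorem DEIntegrand.norm_integral_sub_sum_le (H : DEIntegrand f d K α β) (hn₀ : 0 < n)
    (hn : max α β * Real.exp 1 ≤ 2 * (d * n))
    (hh : h = Real.log (2 * (d * n) / min α β) / n)
    (hM : Real.log (2 * (d * n) / α) ≤ M * h) (hN : Real.log (2 * (d * n) / β) ≤ N * h) (b : ℝ) :
    ‖(∫ x in Iic b, deF f (x : ℂ)) -
        ∑ k ∈ Finset.Icc (-M) N, deF f (k * h : ℝ) * (J k h b : ℝ)‖ ≤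
      errConst d K α β * epsDE d (2 * min α β) n := by
  have hh₀ := step_pos H.alpha_pos H.beta_pos hn₀ hn hh
  have hMN := neg_le_of_log_le H.alpha_pos H.beta_pos hh₀ hn hM hN
  rw [errConst_eq, epsDE_two_mul hh, mul_add, add_mul]
  exact (norm_sub_le_norm_sub_add_norm_sub ..).trans (add_le_add
    (H.discretization_error_le hn₀ hn hh b)
    ((H.truncation_error hh₀ b hMN).trans (truncation_bound_le H.pos H.nonneg H.alpha_pos
      H.alpha_le_one H.beta_pos hn₀ hn hh hM hN)))

theorem DEIntegrand.integrable_deF (H : DEIntegrand f d K α β) :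
    Integrable fun x : ℝ => deF f x := by
  obtain ⟨_, hdecay⟩ := H.stripDecay_deF (half_pos H.pos) (half_lt_self H.pos)
  exact hdecay.integrable_ofReal

end ErrorBound

end SincDE

theorem theorem3p6_general (d K α β μ ν h : ℝ) (n : ℕ) (M N : ℤ) (f : ℂ → ℂ)
    (hd : 0 < d) (hd' : d < Real.pi / 2) (hα : 0 < α) (hα1 : α ≤ 1) (hβ : 0 < β)
    (hf : DifferentiableOn ℂ f (SincDE.psi '' SincDE.strip d))
    (hfE : ∀ z ∈ SincDE.psi '' SincDE.strip d, ‖f z‖ ≤ K * ‖SincDE.E3 α β z‖)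
    (hμ : μ = min α β) (hν : ν = max α β)
    (hh : h = Real.log (2 * d * n / μ) / n)
    (hM : M = SincDE.lowerM α β h n) (hN : N = SincDE.upperN α β h n)
    (hn : ν * Real.exp 1 / (2 * d) ≤ n) :
    ∀ τ : ℝ, 0 < τ →
      IntervalIntegrable (fun t : ℝ => f (t : ℂ)) MeasureTheory.volume 0 τ ∧
      ‖(∫ t in (0 : ℝ)..τ, f (t : ℂ)) -
          ∑ k ∈ Finset.Icc (-M) N,
            f ((SincDE.psiReal (k * h) : ℝ) : ℂ) * ((deriv SincDE.psiReal (k * h) : ℝ) : ℂ) *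
              ((SincDE.J k h (SincDE.psiInv τ) : ℝ) : ℂ)‖
        ≤ SincDE.errConst d K α β * SincDE.epsDE d (2 * μ) n := by
  intro τ hτ
  subst hμ hν hM hN
  have H : SincDE.DEIntegrand f d K α β := ⟨hd, hd', hα, hα1, hβ, hf, hfE⟩
  have hn₀ : 0 < n := Nat.cast_pos.1 (lt_of_lt_of_le (by positivity) hn)
  rw [div_le_iff₀' (by positivity), mul_assoc] at hn
  rw [mul_assoc] at hh
  have hh₀ : 0 < h := SincDE.step_pos hα hβ hn₀ hn hh
  have hnh : n * h = Real.log (2 * (d * n) / min α β) := by rw [hh]; field_simp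
  refine ⟨SincDE.intervalIntegrable_of_integrable_deF H.integrable_deF hτ, ?_⟩
  rw [SincDE.intervalIntegral_eq_integral_deF f hτ]
  simp_rw [← SincDE.deF_ofReal]
  exact H.norm_integral_sub_sum_le hn₀ hn hh
    (SincDE.log_le_lowerM_mul hα hβ hh₀ (by positivity) hnh)
    (SincDE.log_le_upperN_mul hα hβ hh₀ (by positivity) hnh) (SincDE.psiInv τ)

theorem theorem3p6 (d K α β μ ν h : ℝ) (n : ℕ) (M N : ℤ) (f : ℂ → ℂ)
    (hd : 0 < d) (hd' : d < Real.pi / 2) (hK : 0 < K) (hα : 0 < α) (hα1 : α ≤ 1) (hβ : 0 < β)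
    (hf : AnalyticOnNhd ℂ f (SincDE.psi '' SincDE.strip d))
    (hfE : ∀ z ∈ SincDE.psi '' SincDE.strip d, ‖f z‖ ≤ K * ‖SincDE.E3 α β z‖)
    (hμ : μ = min α β) (hν : ν = max α β)
    (hh : h = Real.log (2 * d * n / μ) / n)
    (hM : M = SincDE.lowerM α β h n) (hN : N = SincDE.upperN α β h n)
    (hn : ν * Real.exp 1 / (2 * d) ≤ n)
    (hMx : SincDE.xThreshold α ≤ M * h) (hNx : SincDE.xThreshold β ≤ N * h) :
    ∀ τ : ℝ, 0 < τ →
      IntervalIntegrable (fun t : ℝ => f (t : ℂ)) MeasureTheory.volume 0 τ ∧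
      ‖(∫ t in (0 : ℝ)..τ, f (t : ℂ)) -
          ∑ k ∈ Finset.Icc (-M) N,
            f ((SincDE.psiReal (k * h) : ℝ) : ℂ) * ((deriv SincDE.psiReal (k * h) : ℝ) : ℂ) *
              ((SincDE.J k h (SincDE.psiInv τ) : ℝ) : ℂ)‖
        ≤ SincDE.errConst d K α β * SincDE.epsDE d (2 * μ) n :=
  theorem3p6_general d K α β μ ν h n M N f hd hd' hα hα1 hβ hf.differentiableOn hfE hμ hν hh hM hN
    hn
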